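/- Let $\sigma(n)=\sum_{d\mid n}d$ and let $\gamma$ be the Euler–Mascheroni constant. We say that a positive integer $n$ satisfies Robin's inequality if $\sigma(n)<e^{\gamma}n\log\log n$. Let $p_1<p_2<\cdots$ be the sequence of all primes. A Hardy–Ramanujan integer is an integer of the form $\prod_{i=1}^{s}p_i^{e_i}$ with $s\ge 0$ and $e_1\ge e_2\ge\cdots\ge e_s\ge 0$. (1) For every real $x$: if Robin's inequality holds for all Hardy–Ramanujan integers $n$ with $5041\le n\le x$, then it holds for all integers $n$ with $5041\le n\le x$. (2) As $x\to\infty$, the number of Hardy–Ramanujan integers $n\le x$ equals $$\exp\left((1+o(1))\,2\pi\sqrt{\frac{\log x}{3\log\log x}}\right).$$ -/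

import Mathlib

/-- Robin's inequality for `n`: `σ(n) < e^γ n log log n`, where `σ(n)` is the sum of the divisors
of `n` and `γ` is the Euler–Mascheroni constant. -/
def RobinInequality (n : ℕ) : Prop :=
  (ArithmeticFunction.sigma 1 n : ℝ) <
    Real.exp Real.eulerMascheroniConstant * (n : ℝ) * Real.log (Real.log (n : ℝ))

/-- A Hardy–Ramanujan integer: `n = ∏ p_i ^ e_i` over the first `s` primes, with
`e_1 ≥ e_2 ≥ ⋯ ≥ e_s ≥ 0`. Here `Nat.nth Nat.Prime i` is the `i`-th prime, counted from `i = 0`. -/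
def IsHardyRamanujan (n : ℕ) : Prop :=
  ∃ (s : ℕ) (e : Fin s → ℕ), Antitone e ∧ n = ∏ i : Fin s, Nat.nth Nat.Prime (i : ℕ) ^ e i

/-- The number of Hardy–Ramanujan integers `n ≤ x`. -/
noncomputable def hardyRamanujanCount (x : ℝ) : ℕ :=
  Set.ncard {n : ℕ | IsHardyRamanujan n ∧ (n : ℝ) ≤ x}

/-! Part (1) is a rearrangement. Let layer `j` of `n` be the set of primes whose exponent in `n`
exceeds `j`. Then `n` is the product of all members of its layers, and `σ(n)/n` is the corresponding
product of factors that, within a layer, decrease with the prime. Replacing every layer by equally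
many initial primes gives a Hardy–Ramanujan `m ≤ n` with `σ(m)/m ≥ σ(n)/n`
(`exists_isHardyRamanujan_le_of_ne_zero`). As `log log` increases, Robin's inequality passes from
`m` to `n` when `m ≥ 5041`. If `m ≤ 5040`, then `σ(m)/m ≤ σ(5040)/5040`, which lies below `e^γ log
log n` once `n ≥ 6200`; the remaining `n < 6200` are checked by computation.

Part (2) is a partition problem. Hardy–Ramanujan integers are exactly the products of primorials, in
a unique way, so their logarithms are sums of parts `θ_k = logPrimorial k ~ k log k`. Sending the
`k`-th prime to its primorial turns the positive integers multiplicatively into the Hardy–Ramanujan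
integers, and the Euler product gives `∑ m^(-s) = exp (partitionLog s)` (`tsum_primorialRpow`).
Expanding the logarithm, `partitionLog s ~ (π²/6) / (s log (1/s))` as `s → 0+`
(`tendsto_mul_partitionLog`).

A Tauberian argument recovers the count up to `e^u`. With `B = mainTerm u` and `s = B/u`, both `s u`
and, asymptotically, `partitionLog s` equal `B`. Rankin's bound gives `log count ≤ (2+o(1)) B`.
Conversely, terms whose logarithm is far from `u` contribute a negligible part of the series at `s`,
as seen by comparison with the series at `(1±η)s` (`exp_partitionLog_le`), so the terms near `u`
must number `exp((2-o(1))B)`. -/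

/-! ### Exponents of Hardy–Ramanujan integers -/

theorem factorization_prod_nth_prime {s : ℕ} (e : Fin s → ℕ) (j : ℕ) :
    (∏ i : Fin s, Nat.nth Nat.Prime (i : ℕ) ^ e i).factorization (Nat.nth Nat.Prime j) =
      if h : j < s then e ⟨j, h⟩ else 0 := by
  rw [Nat.factorization_prod fun i _ => pow_ne_zero _ (Nat.prime_nth_prime _).ne_zero]
  simp only [Nat.factorization_pow, Finsupp.coe_finsetSum, Finset.sum_apply, Finsupp.smul_apply,
    (Nat.prime_nth_prime _).factorization, Finsupp.single_apply,
    (Nat.nth_injective Nat.infinite_setOfPred_prime).eq_iff, smul_eq_mul, mul_ite, mul_one, mul_zero]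
  split_ifs with h
  · rw [Finset.sum_eq_single ⟨j, h⟩]
    · simp
    · intro b _ hb
      rw [if_neg]
      exact fun hbj => hb (Fin.ext hbj)
    · simp
  · exact Finset.sum_eq_zero fun i _ => if_neg (by have := i.2; omega)

theorem exists_nth_prime_eq {q : ℕ} (hq : q.Prime) : ∃ j, Nat.nth Nat.Prime j = q :=
  ⟨_, Nat.nth_count hq⟩

theorem eq_of_factorization_nth_prime_eq {a b : ℕ} (ha : a ≠ 0) (hb : b ≠ 0)
    (h : ∀ j, a.factorization (Nat.nth Nat.Prime j) = b.factorization (Nat.nth Nat.Prime j)) :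
    a = b := by
  refine Nat.eq_of_factorization_eq ha hb fun q => ?_
  by_cases hq : q.Prime
  · obtain ⟨j, rfl⟩ := exists_nth_prime_eq hq
    exact h j
  · simp [Nat.factorization_eq_zero_of_not_prime _ hq]

theorem factorization_nth_prime_eq_zero {n j : ℕ} (h : n ≤ j) :
    n.factorization (Nat.nth Nat.Prime j) = 0 :=
  Nat.factorization_eq_zero_of_lt (by have := Nat.add_two_le_nth_prime j; omega)

theorem isHardyRamanujan_iff {n : ℕ} :
    IsHardyRamanujan n ↔
      n ≠ 0 ∧ Antitone fun i => n.factorization (Nat.nth Nat.Prime i) := by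
  constructor
  · rintro ⟨s, e, he, rfl⟩
    refine ⟨Finset.prod_ne_zero_iff.2 fun i _ => pow_ne_zero _ (Nat.prime_nth_prime _).ne_zero, ?_⟩
    intro i j hij
    simp only [factorization_prod_nth_prime]
    split_ifs with h1 h2
    · exact he (by simpa using hij)
    · omega
    · exact Nat.zero_le _
    · exact le_rfl
  · rintro ⟨hn, h⟩
    refine ⟨n, fun i => n.factorization (Nat.nth Nat.Prime i), fun i j hij => h hij, ?_⟩
    refine eq_of_factorization_nth_prime_eq hn
      (Finset.prod_ne_zero_iff.2 fun i _ => pow_ne_zero _ (Nat.prime_nth_prime _).ne_zero) ?_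
    intro j
    rw [factorization_prod_nth_prime]
    split_ifs with hj
    · rfl
    · exact factorization_nth_prime_eq_zero (by omega)

/-! ### Rearranging the primes of an integer, layer by layer -/

theorem nth_prime_card_le {S : Finset ℕ} {a : ℕ} (ha : a.Prime)
    (hS : ∀ q ∈ S, q.Prime ∧ q < a) : Nat.nth Nat.Prime S.card ≤ a := by
  have h : S.card ≤ Nat.count Nat.Prime a := by
    rw [Nat.count_eq_card_filter_range]
    exact Finset.card_le_card fun q hq => by simpa using ⟨(hS q hq).2, (hS q hq).1⟩
  calc _ ≤ Nat.nth Nat.Prime (Nat.count Nat.Prime a) :=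
        Nat.nth_monotone Nat.infinite_setOfPred_prime h
    _ = a := Nat.nth_count ha

/-- The `i`-th smallest member of a set of primes is at least the `i`-th prime, so the factors
compare one by one when the maximum is split off. -/
theorem prod_primes_le_prod_nth_prime {S : Finset ℕ} (hS : ∀ q ∈ S, q.Prime) {g : ℕ → ℝ}
    (hg0 : ∀ q, q.Prime → 0 ≤ g q) (hg : ∀ q r, q.Prime → q ≤ r → g r ≤ g q) :
    ∏ q ∈ S, g q ≤ ∏ i ∈ Finset.range S.card, g (Nat.nth Nat.Prime i) := by
  induction S using Finset.induction_on_max with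
  | empty => simp
  | insert a s ha ih =>
    have hmem : a ∉ s := fun h => lt_irrefl _ (ha a h)
    have hap : a.Prime := hS a (Finset.mem_insert_self _ _)
    have hs : ∀ q ∈ s, q.Prime := fun q hq => hS q (Finset.mem_insert_of_mem hq)
    rw [Finset.prod_insert hmem, Finset.card_insert_of_notMem hmem, Finset.prod_range_succ,
      mul_comm]
    exact mul_le_mul (ih hs)
      (hg _ _ (Nat.prime_nth_prime _) (nth_prime_card_le hap fun q hq => ⟨hs q hq, ha q hq⟩))
      (hg0 _ hap) (Finset.prod_nonneg fun i _ => hg0 _ (Nat.prime_nth_prime _))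

theorem prod_nth_prime_le_prod_primes {S : Finset ℕ} (hS : ∀ q ∈ S, q.Prime) :
    ∏ i ∈ Finset.range S.card, Nat.nth Nat.Prime i ≤ ∏ q ∈ S, q := by
  induction S using Finset.induction_on_max with
  | empty => simp
  | insert a s ha ih =>
    have hmem : a ∉ s := fun h => lt_irrefl _ (ha a h)
    have hap : a.Prime := hS a (Finset.mem_insert_self _ _)
    have hs : ∀ q ∈ s, q.Prime := fun q hq => hS q (Finset.mem_insert_of_mem hq)
    rw [Finset.prod_insert hmem, Finset.card_insert_of_notMem hmem, Finset.prod_range_succ,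
      mul_comm]
    exact Nat.mul_le_mul (nth_prime_card_le hap fun q hq => ⟨hs q hq, ha q hq⟩) (ih hs)

theorem prod_primeFactors_range_factorization {M : Type*} [CommMonoid M] (g : ℕ → ℕ → M)
    {n J : ℕ} (hJ : ∀ q, n.factorization q ≤ J) :
    ∏ q ∈ n.primeFactors, ∏ j ∈ Finset.range (n.factorization q), g j q =
      ∏ j ∈ Finset.range J, ∏ q ∈ n.primeFactors with j < n.factorization q, g j q := by
  refine Finset.prod_comm' fun q j => ?_
  simp only [Finset.mem_range, Finset.mem_filter]
  exact ⟨fun h => ⟨⟨h.1, h.2⟩, h.2.trans_le (hJ q)⟩, fun h => h.1⟩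

/-- The factor by which `σ(q ^ j) / q ^ j` grows when `j` is replaced by `j + 1`. -/
noncomputable def abundancyStep (j q : ℕ) : ℝ :=
  1 + (∑ i ∈ Finset.range (j + 1), (q : ℝ) ^ (i + 1))⁻¹

theorem abundancyStep_nonneg (j q : ℕ) : 0 ≤ abundancyStep j q := by
  unfold abundancyStep; positivity

theorem abundancyStep_anti (j : ℕ) {q r : ℕ} (hq : 0 < q) (h : q ≤ r) :
    abundancyStep j r ≤ abundancyStep j q := by
  unfold abundancyStep
  have hq' : (0 : ℝ) < q := by exact_mod_cast hq
  gcongr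

/-- Telescoping: the sum inside `abundancyStep j q` is `q σ(q^j)`, and `σ(q^(j+1)) = 1 + q σ(q^j)`.
-/
theorem prod_abundancyStep (e : ℕ) {q : ℕ} (hq : q.Prime) :
    ∏ j ∈ Finset.range e, abundancyStep j q =
      (ArithmeticFunction.sigma 1 (q ^ e) : ℝ) / (q : ℝ) ^ e := by
  have hq' : (0 : ℝ) < q := by exact_mod_cast hq.pos
  rw [ArithmeticFunction.sigma_one_apply_prime_pow hq]
  induction e with
  | zero => simp
  | succ e ih =>
    rw [Finset.prod_range_succ, ih]
    unfold abundancyStep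
    push_cast
    have h1 : ∑ i ∈ Finset.range (e + 1), (q : ℝ) ^ (i + 1) =
        q * ∑ i ∈ Finset.range (e + 1), (q : ℝ) ^ i := by
      rw [Finset.mul_sum]; exact Finset.sum_congr rfl fun i _ => pow_succ' _ _
    have h2 : (0 : ℝ) < ∑ i ∈ Finset.range (e + 1), (q : ℝ) ^ i :=
      Finset.sum_pos (fun i _ => by positivity) (by simp)
    rw [Finset.sum_range_succ' _ (e + 1), h1]
    field_simp
    ring

theorem sigma_div_eq_prod_abundancyStep {n J : ℕ} (hn : n ≠ 0)
    (hJ : ∀ q, n.factorization q ≤ J) :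
    (ArithmeticFunction.sigma 1 n : ℝ) / n =
      ∏ j ∈ Finset.range J, ∏ q ∈ n.primeFactors with j < n.factorization q,
        abundancyStep j q := by
  rw [← prod_primeFactors_range_factorization _ hJ,
    ArithmeticFunction.isMultiplicative_sigma.multiplicative_factorization _ hn]
  have hn' : (n : ℝ) = ∏ q ∈ n.primeFactors, (q : ℝ) ^ n.factorization q := by
    exact_mod_cast (Nat.prod_factorization_pow_eq_self hn).symm
  rw [hn', Finsupp.prod, Nat.cast_prod, Nat.support_factorization, ← Finset.prod_div_distrib]
  refine Finset.prod_congr rfl fun q hq => ?_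
  rw [prod_abundancyStep _ (Nat.prime_of_mem_primeFactors hq)]

theorem eq_prod_range_prod_primeFactors {n J : ℕ} (hn : n ≠ 0)
    (hJ : ∀ q, n.factorization q ≤ J) :
    n = ∏ j ∈ Finset.range J, ∏ q ∈ n.primeFactors with j < n.factorization q, q := by
  rw [← prod_primeFactors_range_factorization (fun _ q => q) hJ]
  conv_lhs => rw [← Nat.prod_factorization_pow_eq_self hn]
  rw [Finsupp.prod, Nat.support_factorization]
  exact Finset.prod_congr rfl fun q _ => by simp

theorem factorization_prod_range_nth_prime (J : ℕ) (s : ℕ → ℕ) (i : ℕ) :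
    (∏ j ∈ Finset.range J, ∏ i ∈ Finset.range (s j), Nat.nth Nat.Prime i).factorization
      (Nat.nth Nat.Prime i) = {j ∈ Finset.range J | i < s j}.card := by
  have hp (i : ℕ) : Nat.nth Nat.Prime i ≠ 0 := (Nat.prime_nth_prime i).ne_zero
  rw [Nat.factorization_prod fun j _ => Finset.prod_ne_zero_iff.2 fun i _ => hp i,
    Finsupp.coe_finsetSum, Finset.sum_apply, Finset.card_filter]
  refine Finset.sum_congr rfl fun j _ => ?_
  rw [Nat.factorization_prod fun i _ => hp i, Finsupp.coe_finsetSum, Finset.sum_apply]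
  simp [Finsupp.single_apply,
    (Nat.nth_injective Nat.infinite_setOfPred_prime).eq_iff]

/-- Conjugation of partitions: the exponents are the conjugate of the layer sizes, and conjugating
back shows that layer `j` of the rearranged integer is exactly the first `s j` primes. -/
theorem lt_card_filter_iff_of_antitone {s : ℕ → ℕ} (hs : Antitone s) {J i j : ℕ} (hj : j < J) :
    j < {j ∈ Finset.range J | i < s j}.card ↔ i < s j := by
  constructor
  · intro h
    by_contra hc
    have : {j ∈ Finset.range J | i < s j} ⊆ Finset.range j := fun k hk => by
      simp only [Finset.mem_filter, Finset.mem_range] at hk ⊢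
      by_contra hjk
      have := hs (not_lt.1 hjk)
      omega
    have := Finset.card_le_card this
    simp at this
    omega
  · intro h
    have : Finset.range (j + 1) ⊆ {j ∈ Finset.range J | i < s j} := fun k hk => by
      simp only [Finset.mem_filter, Finset.mem_range] at hk ⊢
      have := hs (Nat.lt_succ_iff.1 hk)
      omega
    have := Finset.card_le_card this
    simp at this
    omega

theorem exists_isHardyRamanujan_le_of_ne_zero {n : ℕ} (hn : n ≠ 0) :
    ∃ m, IsHardyRamanujan m ∧ m ≤ n ∧
      (ArithmeticFunction.sigma 1 n : ℝ) / n ≤ (ArithmeticFunction.sigma 1 m : ℝ) / m := by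
  set A : ℕ → Finset ℕ := fun j => {q ∈ n.primeFactors | j < n.factorization q} with hA
  set s : ℕ → ℕ := fun j => (A j).card with hs
  have hAp (j : ℕ) : ∀ q ∈ A j, q.Prime := fun q hq =>
    Nat.prime_of_mem_primeFactors (Finset.mem_filter.1 hq).1
  have hanti : Antitone s := fun j k hjk => Finset.card_le_card fun q hq => by
    simp only [hA, Finset.mem_filter] at hq ⊢
    exact ⟨hq.1, by omega⟩
  have hJ : ∀ q, n.factorization q ≤ n := fun q => (Nat.factorization_lt q hn).le
  set m := ∏ j ∈ Finset.range n, ∏ i ∈ Finset.range (s j), Nat.nth Nat.Prime i with hm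
  have hm0 : m ≠ 0 := Finset.prod_ne_zero_iff.2 fun j _ => Finset.prod_ne_zero_iff.2 fun i _ =>
    (Nat.prime_nth_prime i).ne_zero
  have hfac := factorization_prod_range_nth_prime n s
  rw [← hm] at hfac
  have hJm : ∀ q, m.factorization q ≤ n := fun q => by
    by_cases hq : q.Prime
    · obtain ⟨i, rfl⟩ := exists_nth_prime_eq hq
      rw [hfac]
      exact (Finset.card_filter_le _ _).trans (by simp)
    · simp [Nat.factorization_eq_zero_of_not_prime _ hq]
  refine ⟨m, isHardyRamanujan_iff.2 ⟨hm0, fun i k hik => ?_⟩, ?_, ?_⟩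
  · simp only [hfac]
    refine Finset.card_le_card fun j hj => ?_
    simp only [Finset.mem_filter] at hj ⊢
    exact ⟨hj.1, by omega⟩
  · conv_rhs => rw [eq_prod_range_prod_primeFactors hn hJ]
    exact Finset.prod_le_prod' fun j _ => prod_nth_prime_le_prod_primes (hAp j)
  · rw [sigma_div_eq_prod_abundancyStep hn hJ, sigma_div_eq_prod_abundancyStep hm0 hJm]
    refine Finset.prod_le_prod
      (fun j _ => Finset.prod_nonneg fun q _ => abundancyStep_nonneg j q) fun j hj => ?_
    have hset : {q ∈ m.primeFactors | j < m.factorization q} =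
        (Finset.range (s j)).image (Nat.nth Nat.Prime) := by
      ext q
      simp only [Finset.mem_filter, Finset.mem_image, Finset.mem_range]
      constructor
      · rintro ⟨hq, hjq⟩
        obtain ⟨i, rfl⟩ := exists_nth_prime_eq (Nat.prime_of_mem_primeFactors hq)
        rw [hfac, lt_card_filter_iff_of_antitone hanti (Finset.mem_range.1 hj)] at hjq
        exact ⟨i, hjq, rfl⟩
      · rintro ⟨i, hi, rfl⟩
        have : j < m.factorization (Nat.nth Nat.Prime i) := by
          rwa [hfac, lt_card_filter_iff_of_antitone hanti (Finset.mem_range.1 hj)]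
        refine ⟨?_, this⟩
        rw [← Nat.support_factorization, Finsupp.mem_support_iff]
        omega
    rw [hset, Finset.prod_image ((Nat.nth_injective Nat.infinite_setOfPred_prime).injOn)]
    exact prod_primes_le_prod_nth_prime (hAp j) (fun q _ => abundancyStep_nonneg j q)
      fun q r hq hqr => abundancyStep_anti j hq.pos hqr

/-! ### Finite computations and numerical constants -/

/-- The sum of the divisors of `n` that occur in a pair `d, n / d` with `d ≤ k`, `d ≤ n / d`. -/
def pairedDivisorSum (n : ℕ) (k : ℕ) : ℕ :=
  Nat.rec 0 (fun d s => bif n % (d + 1) == 0 then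
    (bif Nat.blt ((d + 1) * (d + 1)) n then s + (d + 1) + n / (d + 1) else
      bif (d + 1) * (d + 1) == n then s + (d + 1) else s) else s) k

/-- Whether `P` holds for all natural numbers below `k`. -/
def allBelow (P : ℕ → Bool) (k : ℕ) : Bool :=
  Nat.rec true (fun d s => bif P d then s else false) k

theorem allBelow_spec {P : ℕ → Bool} {k : ℕ} (h : allBelow P k = true) {i : ℕ} (hi : i < k) :
    P i = true := by
  induction k with
  | zero => omega
  | succ k ih =>
    have h' : (bif P k then allBelow P k else false) = true := h
    cases hP : P k with
    | false => simp [hP] at h'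
    | true =>
      rw [hP, cond_true] at h'
      rcases Nat.lt_succ_iff_lt_or_eq.1 hi with hlt | rfl
      · exact ih h' hlt
      · exact hP

theorem pairedDivisorSum_eq (n k : ℕ) :
    pairedDivisorSum n k = ∑ d ∈ Finset.range k, if n % (d + 1) = 0 then
      (if (d + 1) * (d + 1) < n then (d + 1) + n / (d + 1) else
        if (d + 1) * (d + 1) = n then d + 1 else 0) else 0 := by
  induction k with
  | zero => rfl
  | succ k ih =>
    rw [Finset.sum_range_succ, ← ih]
    change (bif n % (k + 1) == 0 then
      (bif Nat.blt ((k + 1) * (k + 1)) n then pairedDivisorSum n k + (k + 1) + n / (k + 1) else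
      bif (k + 1) * (k + 1) == n then pairedDivisorSum n k + (k + 1) else pairedDivisorSum n k)
        else pairedDivisorSum n k) = _
    have hb (a b : ℕ) : Nat.blt a b = decide (a < b) := by
      rw [Bool.eq_iff_iff]; simp [Nat.blt_eq]
    simp only [hb, Bool.cond_eq_ite, beq_iff_eq, decide_eq_true_eq]
    split_ifs <;> omega

/-- Divisors pair up as `d` and `n / d`, the square root counting once, and the smaller member of
each pair is at most `k`. Only an upper bound is needed, so overlaps can be ignored. -/
theorem sigma_one_le_pairedDivisorSum {n k : ℕ} (hn : n < (k + 1) * (k + 1)) :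
    ArithmeticFunction.sigma 1 n ≤ pairedDivisorSum n k := by
  rcases Nat.eq_zero_or_pos n with rfl | hpos
  · simp
  rw [ArithmeticFunction.sigma_one_apply, pairedDivisorSum_eq]
  set S := {d ∈ n.divisors | d * d < n}
  set T := {d ∈ n.divisors | d * d = n}
  have hdiv : n.divisors ⊆ (S ∪ S.image (fun d => n / d)) ∪ T := by
    intro d hd
    have hdn := Nat.dvd_of_mem_divisors hd
    obtain ⟨c, hc⟩ := hdn
    have hd0 : 0 < d := Nat.pos_of_mem_divisors hd
    simp only [Finset.mem_union, Finset.mem_image, S, T, Finset.mem_filter, Nat.mem_divisors]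
    rcases lt_trichotomy (d * d) n with h | h | h
    · exact Or.inl (Or.inl ⟨⟨⟨c, hc⟩, hpos.ne'⟩, h⟩)
    · exact Or.inr ⟨⟨⟨c, hc⟩, hpos.ne'⟩, h⟩
    · have hcd : c < d := by
        rw [hc] at h; exact lt_of_mul_lt_mul_left h (Nat.zero_le _)
      have hc0 : 0 < c := Nat.pos_of_ne_zero fun h0 => by simp [h0] at hc; omega
      refine Or.inl (Or.inr ⟨c, ⟨⟨⟨d, by rw [hc, mul_comm]⟩, hpos.ne'⟩, ?_⟩, ?_⟩)
      · rw [hc]; exact mul_lt_mul_of_pos_right hcd hc0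
      · rw [hc]; exact Nat.mul_div_cancel _ hc0
  have h1 : ∑ d ∈ n.divisors, d ≤ ∑ d ∈ S, (d + n / d) + ∑ d ∈ T, d := by
    calc ∑ d ∈ n.divisors, d ≤ ∑ d ∈ (S ∪ S.image (fun d => n / d)) ∪ T, d :=
          Finset.sum_le_sum_of_subset hdiv
      _ ≤ ∑ d ∈ S ∪ S.image (fun d => n / d), d + ∑ d ∈ T, d := by
          rw [← Finset.sum_union_inter]; exact Nat.le_add_right _ _
      _ ≤ (∑ d ∈ S, d + ∑ d ∈ S.image (fun d => n / d), d) + ∑ d ∈ T, d := by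
          rw [← Finset.sum_union_inter (s₁ := S)]; omega
      _ ≤ _ := by
          rw [Finset.sum_add_distrib]
          gcongr
          exact Finset.sum_image_le_of_nonneg (fun _ _ => Nat.zero_le _)
  refine h1.trans ?_
  have h2 : ∑ d ∈ S, (d + n / d) + ∑ d ∈ T, d = ∑ d ∈ n.divisors,
      (if d * d < n then d + n / d else if d * d = n then d else 0) := by
    rw [Finset.sum_filter, Finset.sum_filter, ← Finset.sum_add_distrib]
    refine Finset.sum_congr rfl fun d _ => ?_
    split_ifs <;> omega
  rw [h2, ← Finset.sum_filter_of_ne (p := fun d => d ≤ k), Finset.sum_filter]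
  · have h3 : n.divisors ⊆ (Finset.range n).image (· + 1) := fun d hd => by
      have := Nat.divisor_le hd
      have := Nat.pos_of_mem_divisors hd
      exact Finset.mem_image.2 ⟨d - 1, by simp; omega, by omega⟩
    calc _ = ∑ d ∈ n.divisors with d ≤ k,
          (if d * d < n then d + n / d else if d * d = n then d else 0) := by
          rw [Finset.sum_filter]
      _ = ∑ d ∈ n.divisors with d ≤ k, if n % ((d - 1) + 1) = 0 then
            (if ((d - 1) + 1) * ((d - 1) + 1) < n then ((d - 1) + 1) + n / ((d - 1) + 1) else
            if ((d - 1) + 1) * ((d - 1) + 1) = n then (d - 1) + 1 else 0) else 0 := by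
          refine Finset.sum_congr rfl fun d hd => ?_
          have hd' := (Finset.mem_filter.1 hd).1
          have := Nat.pos_of_mem_divisors hd'
          rw [Nat.sub_add_cancel this,
            if_pos (Nat.mod_eq_zero_of_dvd (Nat.dvd_of_mem_divisors hd'))]
      _ = ∑ d ∈ ({d ∈ n.divisors | d ≤ k}.image (· - 1)), if n % (d + 1) = 0 then
            (if (d + 1) * (d + 1) < n then (d + 1) + n / (d + 1) else
            if (d + 1) * (d + 1) = n then d + 1 else 0) else 0 := by
          rw [Finset.sum_image]
          intro a ha b hb hab
          have ha' := Nat.pos_of_mem_divisors (Finset.mem_filter.1 ha).1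
          have hb' := Nat.pos_of_mem_divisors (Finset.mem_filter.1 hb).1
          simp only at hab
          omega
      _ ≤ _ := by
          refine Finset.sum_le_sum_of_subset fun d hd => ?_
          obtain ⟨a, ha, rfl⟩ := Finset.mem_image.1 hd
          have ha' := Nat.pos_of_mem_divisors (Finset.mem_filter.1 ha).1
          have := (Finset.mem_filter.1 ha).2
          simp; omega
  · intro d hd hne
    by_contra hk
    have : (k + 1) * (k + 1) ≤ d * d := Nat.mul_le_mul (by omega) (by omega)
    rw [if_neg (by omega), if_neg (by omega)] at hne
    exact hne rfl

theorem ten_mul_sigma_one_le {n : ℕ} (h1 : 5041 ≤ n) (h2 : n < 6200) :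
    10 * ArithmeticFunction.sigma 1 n ≤ 37 * n := by
  -- Everything is built from recursors and Boolean tests, which the kernel can evaluate. Here `1159
  -- = 6200 - 5041`, and `78` suffices because `79² = 6241 > 6199`.
  have key : allBelow (fun i => Nat.ble (10 * pairedDivisorSum (5041 + i) 78) (37 * (5041 + i)))
      1159 = true := by
    set_option maxRecDepth 100000 in decide +kernel
  have h := allBelow_spec key (i := n - 5041) (by omega)
  rw [Nat.add_sub_cancel' h1] at h
  have := Nat.le_of_ble_eq_true h
  have := sigma_one_le_pairedDivisorSum (n := n) (k := 78) (by omega)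
  omega

theorem sigma_one_le_of_thirty_dvd {m : ℕ} (hd : 30 ∣ m) (hm : m ≤ 5040) :
    5040 * ArithmeticFunction.sigma 1 m ≤ 19344 * m := by
  -- `5040 = 30 * 168`, `19344 = σ(5040)`, and `72² > 5040`.
  have key : allBelow (fun i => Nat.ble (5040 * pairedDivisorSum (30 * i) 71) (19344 * (30 * i)))
      169 = true := by
    set_option maxRecDepth 100000 in decide +kernel
  obtain ⟨k, rfl⟩ := hd
  have h := Nat.le_of_ble_eq_true (allBelow_spec key (i := k) (by omega))
  have := sigma_one_le_pairedDivisorSum (n := 30 * k) (k := 71) (by omega)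
  omega

/-- The index `127` makes the logarithm in the Euler–Mascheroni sequence `log 128 = 7 log 2`, for
which a decimal bound is known. -/
theorem exp_eulerMascheroniConstant_gt :
    (1.773 : ℝ) < Real.exp Real.eulerMascheroniConstant := by
  have h1 := Real.eulerMascheroniSeq_lt_eulerMascheroniConstant 127
  have h2 : (0.5731 : ℝ) < Real.eulerMascheroniSeq 127 := by
    have hh : (0.5731 + 7 * 0.6931471808 : ℚ) < harmonic 127 := by decide +kernel
    have hh' : (0.5731 + 7 * 0.6931471808 : ℝ) < (harmonic 127 : ℝ) := by
      have := (Rat.cast_lt (K := ℝ)).2 hh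
      push_cast at this
      convert this using 2
    have hl : Real.log ((127 : ℕ) + 1 : ℝ) = 7 * Real.log 2 := by
      rw [show (((127 : ℕ) : ℝ) + 1) = 2 ^ 7 by norm_num, Real.log_pow]; norm_num
    have := Real.log_two_lt_d9
    rw [Real.eulerMascheroniSeq, hl]
    linarith
  have h3 : (0.5731 : ℝ) ≤ Real.eulerMascheroniConstant := by linarith
  refine lt_of_lt_of_le ?_ (Real.exp_le_exp.2 h3)
  refine lt_of_lt_of_le ?_ (Real.sum_le_exp_of_nonneg (by norm_num) 6)
  norm_num [Finset.sum_range_succ, Nat.factorial]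

/-- The constant is chosen so that `1.773 * 2.13 > 3.7`, the bound on `σ(n)/n` below `6200`. -/
theorem log_log_gt_of_le {x : ℝ} (hx : 5041 ≤ x) : (2.13 : ℝ) < Real.log (Real.log x) := by
  have he := Real.exp_one_lt_d9
  have h1 : (8.5 : ℝ) < Real.log x := by
    rw [Real.lt_log_iff_exp_lt (by linarith)]
    refine lt_of_lt_of_le ?_ hx
    have : Real.exp 8.5 = Real.exp 1 ^ 8 * Real.exp 0.5 := by
      rw [← Real.exp_nat_mul, ← Real.exp_add]; norm_num
    rw [this]
    have h5 : Real.exp 0.5 ≤ 1.6488 := by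
      refine (Real.exp_bound' (by norm_num) (by norm_num) (n := 6) (by norm_num)).trans ?_
      norm_num [Finset.sum_range_succ, Nat.factorial]
    calc _ ≤ (2.7182818286 : ℝ) ^ 8 * 1.6488 := by gcongr
      _ < _ := by norm_num
  rw [Real.lt_log_iff_exp_lt (by linarith)]
  refine lt_of_lt_of_le ?_ h1.le
  have : Real.exp 2.13 = Real.exp 1 ^ 2 * Real.exp 0.13 := by
    rw [← Real.exp_nat_mul, ← Real.exp_add]; norm_num
  rw [this]
  have h5 : Real.exp 0.13 ≤ 1.14 := by
    refine (Real.exp_bound' (by norm_num) (by norm_num) (n := 6) (by norm_num)).trans ?_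
    norm_num [Finset.sum_range_succ, Nat.factorial]
  calc _ ≤ (2.7182818286 : ℝ) ^ 2 * 1.14 := by gcongr
    _ < _ := by norm_num

/-- Here `1.773 * 2.165 > 19344 / 5040` by a narrow margin, which dictates the threshold `6200`. -/
theorem log_log_gt_of_le' {x : ℝ} (hx : 6200 ≤ x) : (2.165 : ℝ) < Real.log (Real.log x) := by
  have he := Real.exp_one_lt_d9
  have h1 : (8.73 : ℝ) < Real.log x := by
    rw [Real.lt_log_iff_exp_lt (by linarith)]
    refine lt_of_lt_of_le ?_ hx
    have : Real.exp 8.73 = Real.exp 1 ^ 8 * Real.exp 0.73 := by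
      rw [← Real.exp_nat_mul, ← Real.exp_add]; norm_num
    rw [this]
    have h5 : Real.exp 0.73 ≤ 2.0755 := by
      refine (Real.exp_bound' (by norm_num) (by norm_num) (n := 8) (by norm_num)).trans ?_
      norm_num [Finset.sum_range_succ, Nat.factorial]
    calc _ ≤ (2.7182818286 : ℝ) ^ 8 * 2.0755 := by gcongr
      _ < _ := by norm_num
  rw [Real.lt_log_iff_exp_lt (by linarith)]
  refine lt_of_lt_of_le ?_ h1.le
  have : Real.exp 2.165 = Real.exp 1 ^ 2 * Real.exp 0.165 := by
    rw [← Real.exp_nat_mul, ← Real.exp_add]; norm_num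
  rw [this]
  have h5 : Real.exp 0.165 ≤ 1.18 := by
    refine (Real.exp_bound' (by norm_num) (by norm_num) (n := 6) (by norm_num)).trans ?_
    norm_num [Finset.sum_range_succ, Nat.factorial]
  calc _ ≤ (2.7182818286 : ℝ) ^ 2 * 1.18 := by gcongr
    _ < _ := by norm_num

/-- If `5 ∤ m` then `m = 2^a 3^b` and `σ(m)/m ≤ 2 * (3/2) = 3`. Otherwise monotone exponents force
`30 ∣ m`, leaving few multiples of `30` to check. -/
theorem IsHardyRamanujan.sigma_one_le {m : ℕ} (h : IsHardyRamanujan m) (hm : m ≤ 5040) :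
    5040 * ArithmeticFunction.sigma 1 m ≤ 19344 * m := by
  obtain ⟨hm0, hanti⟩ := isHardyRamanujan_iff.1 h
  have n0 : Nat.nth Nat.Prime 0 = 2 := Nat.nth_count Nat.prime_two
  have n1 : Nat.nth Nat.Prime 1 = 3 := by
    have := Nat.nth_count Nat.prime_three
    rwa [show Nat.count Nat.Prime 3 = 1 by decide] at this
  have n2 : Nat.nth Nat.Prime 2 = 5 := by
    have := Nat.nth_count Nat.prime_five
    rwa [show Nat.count Nat.Prime 5 = 2 by decide] at this
  by_cases h5 : m.factorization 5 = 0
  · have hm' : m = 2 ^ m.factorization 2 * 3 ^ m.factorization 3 := by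
      refine eq_of_factorization_nth_prime_eq hm0 (by positivity) fun j => ?_
      rw [Nat.factorization_mul (by positivity) (by positivity), Nat.prime_two.factorization_pow,
        Nat.prime_three.factorization_pow, Finsupp.add_apply, Finsupp.single_apply,
        Finsupp.single_apply]
      have hinj (i : ℕ) : Nat.nth Nat.Prime i = Nat.nth Nat.Prime j ↔ i = j :=
        (Nat.nth_injective Nat.infinite_setOfPred_prime).eq_iff
      have e2 : 2 = Nat.nth Nat.Prime j ↔ 0 = j := by rw [← hinj, n0]
      have e3 : 3 = Nat.nth Nat.Prime j ↔ 1 = j := by rw [← hinj, n1]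
      simp only [e2, e3]
      match j with
      | 0 => simp [n0]
      | 1 => simp [n1]
      | j + 2 =>
        have : m.factorization (Nat.nth Nat.Prime (j + 2)) ≤ m.factorization 5 := by
          have := hanti (show 2 ≤ j + 2 by omega)
          simpa [n2] using this
        simp
        omega
    generalize m.factorization 2 = a at hm'
    generalize m.factorization 3 = b at hm'
    have hs : ArithmeticFunction.sigma 1 m =
        (∑ k ∈ Finset.range (a + 1), 2 ^ k) * ∑ k ∈ Finset.range (b + 1), 3 ^ k := by
      rw [hm', ArithmeticFunction.isMultiplicative_sigma.map_mul_of_coprime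
        (Nat.Coprime.pow _ _ (by norm_num)),
        ArithmeticFunction.sigma_one_apply_prime_pow Nat.prime_two,
        ArithmeticFunction.sigma_one_apply_prime_pow Nat.prime_three]
    have h2 : ∑ k ∈ Finset.range (a + 1), 2 ^ k ≤ 2 * 2 ^ a := by
      have := Nat.geomSum_lt (m := 2) (n := a + 1) (s := Finset.range (a + 1)) le_rfl (by simp)
      rw [pow_succ] at this
      omega
    have h3 : 2 * ∑ k ∈ Finset.range (b + 1), 3 ^ k ≤ 3 * 3 ^ b := by
      have := Nat.geomSum_eq (m := 3) (by norm_num) (b + 1)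
      rw [pow_succ] at this
      omega
    have h4 := Nat.mul_le_mul h2 h3
    have h6 : 2 * ArithmeticFunction.sigma 1 m ≤ 6 * m := by
      have : 6 * m = 2 * 2 ^ a * (3 * 3 ^ b) := by rw [hm']; ring
      rw [hs]; linarith
    omega
  · refine sigma_one_le_of_thirty_dvd ?_ hm
    have h12 : m.factorization 5 ≤ m.factorization 3 := by
      simpa [n1, n2] using hanti (show 1 ≤ 2 by omega)
    have h01 : m.factorization 3 ≤ m.factorization 2 := by
      simpa [n0, n1] using hanti (show 0 ≤ 1 by omega)
    have d5 : 5 ∣ m := Nat.dvd_of_factorization_pos h5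
    have d3 : 3 ∣ m := Nat.dvd_of_factorization_pos (by omega)
    have d2 : 2 ∣ m := Nat.dvd_of_factorization_pos (by omega)
    omega

/-! ### Reduction of Robin's inequality to Hardy–Ramanujan integers -/

theorem robinInequality_iff {n : ℕ} (hn : 0 < n) :
    RobinInequality n ↔ (ArithmeticFunction.sigma 1 n : ℝ) / n <
      Real.exp Real.eulerMascheroniConstant * Real.log (Real.log n) := by
  have : (0 : ℝ) < n := by exact_mod_cast hn
  rw [RobinInequality, div_lt_iff₀ this, mul_right_comm]

theorem robinInequality_of_isHardyRamanujan (x : ℝ)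
    (h : ∀ n : ℕ, IsHardyRamanujan n → 5041 ≤ n → (n : ℝ) ≤ x → RobinInequality n)
    (n : ℕ) (hn : 5041 ≤ n) (hx : (n : ℝ) ≤ x) : RobinInequality n := by
  obtain ⟨m, hm, hmn, hσ⟩ := exists_isHardyRamanujan_le_of_ne_zero (n := n) (by omega)
  have hm0 : 0 < m := Nat.pos_of_ne_zero (isHardyRamanujan_iff.1 hm).1
  have hm0' : (0 : ℝ) < m := by exact_mod_cast hm0
  have hn0 : (0 : ℝ) < n := by exact_mod_cast (show 0 < n by omega)
  have hmn' : (m : ℝ) ≤ n := by exact_mod_cast hmn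
  rw [robinInequality_iff (by omega)]
  have hγ := exp_eulerMascheroniConstant_gt
  rcases le_or_gt 5041 m with h5 | h5
  · have h5' : (5041 : ℝ) ≤ m := by exact_mod_cast h5
    refine hσ.trans_lt (((robinInequality_iff hm0).1 (h m hm h5 (hmn'.trans hx))).trans_le ?_)
    have : 0 < Real.log m := Real.log_pos (by linarith)
    gcongr
  · rcases lt_or_ge n 6200 with h6 | h6
    · have h1 := ten_mul_sigma_one_le hn h6
      have h1' : (10 : ℝ) * ArithmeticFunction.sigma 1 n ≤ 37 * n := by exact_mod_cast h1
      have h2 : (ArithmeticFunction.sigma 1 n : ℝ) / n ≤ 3.7 := by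
        rw [div_le_iff₀ hn0]; linarith
      have h3 := log_log_gt_of_le (x := n) (by exact_mod_cast hn)
      nlinarith
    · have h1 := hm.sigma_one_le (by omega)
      have h1' : (5040 : ℝ) * ArithmeticFunction.sigma 1 m ≤ 19344 * m := by exact_mod_cast h1
      have h2 : (ArithmeticFunction.sigma 1 m : ℝ) / m ≤ 19344 / 5040 := by
        rw [div_le_iff₀ hm0']; linarith
      have h3 := log_log_gt_of_le' (x := n) (by exact_mod_cast h6)
      nlinarith

/-! ### Laplace sums of a sequence asymptotic to `k log k` -/

open Filter Topology in
theorem tendsto_mul_neg_log_nhdsGT_zero :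
    Tendsto (fun s : ℝ => s * -Real.log s) (𝓝[>] 0) (𝓝[>] 0) := by
  refine tendsto_nhdsWithin_iff.2 ⟨?_, ?_⟩
  · have := (Real.continuous_mul_log.tendsto 0).mono_left (nhdsWithin_le_nhds (s := Set.Ioi 0))
    simpa using this.neg
  · filter_upwards [Ioo_mem_nhdsGT (show (0 : ℝ) < 1 by norm_num)] with s hs
    exact mul_pos hs.1 (neg_pos.2 (Real.log_neg hs.1 hs.2))

open Filter Topology in
theorem tendsto_div_one_sub_exp_neg_mul {c : ℝ} (hc : 0 < c) :
    Tendsto (fun h : ℝ => h / (1 - Real.exp (-(c * h)))) (𝓝[>] 0) (𝓝 c⁻¹) := by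
  have hd : HasDerivAt (fun h : ℝ => 1 - Real.exp (-(c * h))) c 0 := by
    have := (((hasDerivAt_id (0 : ℝ)).const_mul c).neg.exp).const_sub 1
    simpa using this
  have h1 := hd.tendsto_slope.mono_left (nhdsWithin_mono 0 (fun x (hx : x ∈ Set.Ioi 0) => ne_of_gt hx))
  refine (h1.inv₀ hc.ne').congr' ?_
  filter_upwards with h
  simp [slope, div_eq_mul_inv, mul_comm]

open Filter Topology in
theorem tendsto_neg_log_nhdsGT_zero :
    Tendsto (fun s : ℝ => -Real.log s) (𝓝[>] 0) atTop :=
  tendsto_neg_atBot_atTop.comp Real.tendsto_log_nhdsGT_zero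

/-- The Laplace transform of the counting measure of a sequence. -/
noncomputable def expSum (θ : ℕ → ℝ) (s : ℝ) : ℝ := ∑' k, Real.exp (-(s * θ k))

theorem expSum_term_le {θ : ℕ → ℝ} (h2 : ∀ k : ℕ, (k + 1) * Real.log 2 ≤ θ k) {s : ℝ} (hs : 0 < s)
    (k : ℕ) : Real.exp (-(s * θ k)) ≤ Real.exp (-(s * Real.log 2)) ^ (k + 1) := by
  rw [← Real.exp_nat_mul, Real.exp_le_exp]
  have := mul_le_mul_of_nonneg_left (h2 k) hs.le
  push_cast
  linarith

theorem exp_neg_mul_log_two_lt_one {s : ℝ} (hs : 0 < s) : Real.exp (-(s * Real.log 2)) < 1 := by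
  have := Real.log_pos (show (1 : ℝ) < 2 by norm_num)
  rw [Real.exp_lt_one_iff]
  have := mul_pos hs this
  linarith

theorem summable_exp_neg_mul {θ : ℕ → ℝ} (h2 : ∀ k : ℕ, (k + 1) * Real.log 2 ≤ θ k) {s : ℝ}
    (hs : 0 < s) : Summable fun k => Real.exp (-(s * θ k)) := by
  refine Summable.of_nonneg_of_le (fun k => (Real.exp_pos _).le) (expSum_term_le h2 hs) ?_
  exact (summable_nat_add_iff 1).2 (summable_geometric_of_lt_one (Real.exp_pos _).le
    (exp_neg_mul_log_two_lt_one hs))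

theorem mul_expSum_le {θ : ℕ → ℝ} (h2 : ∀ k : ℕ, (k + 1) * Real.log 2 ≤ θ k) {s : ℝ}
    (hs : 0 < s) : s * expSum θ s ≤ (Real.log 2)⁻¹ := by
  have hl := Real.log_pos (show (1 : ℝ) < 2 by norm_num)
  set x := Real.exp (-(s * Real.log 2)) with hx
  have hx1 : x < 1 := exp_neg_mul_log_two_lt_one hs
  have hx0 : 0 < x := Real.exp_pos _
  have h1 : expSum θ s ≤ x / (1 - x) := by
    have hg := (hasSum_geometric_of_lt_one hx0.le hx1).mul_left x
    rw [div_eq_mul_inv, ← hg.tsum_eq]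
    refine (summable_exp_neg_mul h2 hs).tsum_le_tsum (fun k => ?_) hg.summable
    rw [← pow_succ']
    exact expSum_term_le h2 hs k
  have h3 : s * Real.log 2 * x ≤ 1 - x := by
    have h4 := Real.add_one_le_exp (s * Real.log 2)
    have h5 : Real.exp (s * Real.log 2) * x = 1 := by rw [hx, ← Real.exp_add]; simp
    nlinarith
  calc s * expSum θ s ≤ s * (x / (1 - x)) := by gcongr
    _ ≤ (Real.log 2)⁻¹ := by
      rw [← mul_div_assoc, div_le_iff₀ (by linarith), inv_mul_eq_div, le_div_iff₀ hl]
      linarith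

theorem expSum_nonneg (θ : ℕ → ℝ) (s : ℝ) : 0 ≤ expSum θ s :=
  tsum_nonneg fun _ => (Real.exp_pos _).le

-- For `k ≤ 1/s` one has `log k ≤ log (1/s)`, so these terms dominate a geometric progression of
-- ratio `exp(-c s log (1/s))`. Its missing tail carries a factor at most `s^c`, which tends to `0`.
open Filter Topology in
theorem exists_tendsto_le_mul_expSum {θ : ℕ → ℝ} (h2 : ∀ k : ℕ, (k + 1) * Real.log 2 ≤ θ k)
    {c : ℝ} (hc : 0 < c) (hθ : ∀ᶠ k : ℕ in atTop, θ k ≤ c * (k * Real.log k)) :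
    ∃ g : ℝ → ℝ, Tendsto g (𝓝[>] 0) (𝓝 c⁻¹) ∧
      ∀ᶠ s in 𝓝[>] 0, g s ≤ s * -Real.log s * expSum θ s := by
  obtain ⟨K, hK⟩ := eventually_atTop.1 hθ
  set h : ℝ → ℝ := fun s => s * -Real.log s with hh
  set r : ℝ → ℝ := fun s => Real.exp (-(c * h s)) with hr
  refine ⟨fun s => h s / (1 - r s) * (r s ^ (K + 1) - s ^ c), ?_, ?_⟩
  · have ht := tendsto_mul_neg_log_nhdsGT_zero
    have e1 := (tendsto_div_one_sub_exp_neg_mul hc).comp ht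
    have e2 : Tendsto r (𝓝[>] 0) (𝓝 1) := by
      have : Tendsto (fun x : ℝ => Real.exp (-(c * x))) (𝓝 0) (𝓝 1) := by
        have : Continuous fun x : ℝ => Real.exp (-(c * x)) := by fun_prop
        simpa using this.tendsto 0
      exact this.comp (ht.mono_right nhdsWithin_le_nhds)
    have e3 : Tendsto (fun s : ℝ => s ^ c) (𝓝[>] 0) (𝓝 0) := by
      have := (Real.continuousAt_rpow_const 0 c (Or.inr hc.le)).tendsto
      rw [Real.zero_rpow hc.ne'] at this
      exact this.mono_left nhdsWithin_le_nhds
    have := e1.mul ((e2.pow (K + 1)).sub e3)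
    rw [one_pow, sub_zero, mul_one] at this
    exact this
  · filter_upwards [Ioo_mem_nhdsGT (show (0 : ℝ) < 1 by norm_num),
      Ioo_mem_nhdsGT (show (0 : ℝ) < 1 / (K + 1) by positivity)] with s hs hsK
    have hL : 0 < -Real.log s := neg_pos.2 (Real.log_neg hs.1 hs.2)
    have hh0 : 0 < h s := mul_pos hs.1 hL
    have hr1 : r s < 1 := by
      simp only [hr]; rw [Real.exp_lt_one_iff]; have := mul_pos hc hh0; linarith
    have hr0 : 0 < r s := Real.exp_pos _
    set N := ⌊1 / s⌋₊ + 1 with hN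
    have hNs : 1 / s < N := by exact_mod_cast Nat.lt_floor_add_one (1 / s)
    have hKN : K + 1 ≤ N := by
      have h3 : (K + 1 : ℝ) < 1 / s := by
        rw [lt_div_iff₀ hs.1]
        have := (lt_div_iff₀ (by positivity)).1 hsK.2
        linarith
      have : ((K + 1 : ℕ) : ℝ) < N := by push_cast; linarith
      exact_mod_cast this.le
    have hsum : ∑ k ∈ Finset.Ico (K + 1) N, r s ^ k ≤ expSum θ s := by
      calc _ ≤ ∑ k ∈ Finset.Ico (K + 1) N, Real.exp (-(s * θ k)) := by
            refine Finset.sum_le_sum fun k hk => ?_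
            rw [Finset.mem_Ico] at hk
            simp only [hr, hh]
            rw [← Real.exp_nat_mul, Real.exp_le_exp]
            have hk0 : (0 : ℝ) < k := by exact_mod_cast (show 0 < k by omega)
            have hks : (k : ℝ) ≤ 1 / s := by
              have : k ≤ ⌊1 / s⌋₊ := by omega
              exact (Nat.cast_le.2 this).trans (Nat.floor_le (by have := hs.1; positivity))
            have hlog : Real.log k ≤ -Real.log s := by
              have := Real.log_le_log hk0 hks
              rwa [one_div, Real.log_inv] at this
            have h5 := hK k (by omega)
            have h6 : θ k ≤ c * (k * -Real.log s) := h5.trans (by gcongr)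
            have := mul_le_mul_of_nonneg_left h6 hs.1.le
            linarith
        _ ≤ _ := (summable_exp_neg_mul h2 hs.1).sum_le_tsum _ fun _ _ => (Real.exp_pos _).le
    have hrN : r s ^ N ≤ s ^ c := by
      simp only [hr, hh]
      rw [← Real.exp_nat_mul, Real.rpow_def_of_pos hs.1, Real.exp_le_exp]
      have h7 : 1 ≤ N * s := by
        rw [div_lt_iff₀ hs.1] at hNs; exact hNs.le
      have := mul_le_mul_of_nonneg_right h7 (mul_pos hc hL).le
      linarith
    have hgeom : h s / (1 - r s) * (r s ^ (K + 1) - r s ^ N) =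
        h s * ∑ k ∈ Finset.Ico (K + 1) N, r s ^ k := by
      rw [geom_sum_Ico' hr1.ne hKN]
      ring
    calc _ ≤ h s / (1 - r s) * (r s ^ (K + 1) - r s ^ N) := by
          have : 0 < 1 - r s := by linarith
          gcongr
      _ = _ := hgeom
      _ ≤ _ := by gcongr

-- About `s^(-c)` initial terms, each at most `1`, are negligible against `1/(s log (1/s))` because
-- `c < 1`. Beyond them `log k ≥ c log (1/s)`, so the terms lie below a geometric progression; this
-- second loss of `c` explains `c ^ 2`.
open Filter Topology in
theorem exists_tendsto_mul_expSum_le {θ : ℕ → ℝ} (h2 : ∀ k : ℕ, (k + 1) * Real.log 2 ≤ θ k)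
    {c : ℝ} (hc : 0 < c) (hc1 : c < 1) (hθ : ∀ᶠ k : ℕ in atTop, c * (k * Real.log k) ≤ θ k) :
    ∃ g : ℝ → ℝ, Tendsto g (𝓝[>] 0) (𝓝 (c ^ 2)⁻¹) ∧
      ∀ᶠ s in 𝓝[>] 0, s * -Real.log s * expSum θ s ≤ g s := by
  obtain ⟨K, hK⟩ := eventually_atTop.1 hθ
  set h : ℝ → ℝ := fun s => s * -Real.log s with hh
  set r : ℝ → ℝ := fun s => Real.exp (-(c ^ 2 * h s)) with hr
  have ht := tendsto_mul_neg_log_nhdsGT_zero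
  refine ⟨fun s => h s * (s ^ (-c) + (K + 1)) + h s / (1 - r s), ?_, ?_⟩
  · have e1 := (tendsto_div_one_sub_exp_neg_mul (pow_pos hc 2)).comp ht
    have e2 : Tendsto (fun s => h s * s ^ (-c)) (𝓝[>] 0) (𝓝 0) := by
      have := (tendsto_log_mul_rpow_nhdsGT_zero (r := 1 - c) (by linarith)).neg
      rw [neg_zero] at this
      refine this.congr' ?_
      filter_upwards [self_mem_nhdsWithin] with s (hs : 0 < s)
      rw [show (1 - c) = 1 + (-c) by ring, Real.rpow_add hs, Real.rpow_one]
      simp only [hh]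
      ring
    have e3 : Tendsto (fun s => h s * (K + 1)) (𝓝[>] 0) (𝓝 0) := by
      have := (ht.mono_right nhdsWithin_le_nhds).mul_const ((K : ℝ) + 1)
      rw [zero_mul] at this
      exact this
    have := (e2.add e3).add e1
    simp only [add_zero, zero_add] at this
    refine this.congr fun s => ?_
    simp only [Function.comp_apply, hr, hh]
    ring
  · filter_upwards [Ioo_mem_nhdsGT (show (0 : ℝ) < 1 by norm_num)] with s hs
    have hL : 0 < -Real.log s := neg_pos.2 (Real.log_neg hs.1 hs.2)
    have hh0 : 0 < h s := mul_pos hs.1 hL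
    have hr1 : r s < 1 := by
      simp only [hr]; rw [Real.exp_lt_one_iff]; have := mul_pos (pow_pos hc 2) hh0; linarith
    have hr0 : 0 < r s := Real.exp_pos _
    have hs0 := hs.1
    set N := ⌊s ^ (-c)⌋₊ + 1 + K with hN
    have hNle : (N : ℝ) ≤ s ^ (-c) + (K + 1) := by
      have := Nat.floor_le (show 0 ≤ s ^ (-c) by positivity)
      rw [hN]; push_cast; linarith
    have hsum : expSum θ s ≤ N + (1 - r s)⁻¹ := by
      have hg := hasSum_geometric_of_lt_one hr0.le hr1
      have hsm := summable_exp_neg_mul h2 hs.1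
      rw [expSum, ← hsm.sum_add_tsum_nat_add N]
      have a1 : ∑ k ∈ Finset.range N, Real.exp (-(s * θ k)) ≤ N := by
        have : ∀ k ∈ Finset.range N, Real.exp (-(s * θ k)) ≤ 1 := fun k _ => by
          rw [Real.exp_le_one_iff]
          have hl := Real.log_pos (show (1 : ℝ) < 2 by norm_num)
          have : 0 ≤ θ k := le_trans (by positivity) (h2 k)
          have := mul_nonneg hs0.le this
          linarith
        simpa using Finset.sum_le_sum this
      have a2 : ∑' k, Real.exp (-(s * θ (k + N))) ≤ (1 - r s)⁻¹ := by
        rw [← hg.tsum_eq]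
        calc _ ≤ ∑' k, r s ^ (k + N) := by
              refine ((summable_nat_add_iff N).2 hsm).tsum_le_tsum (fun k => ?_)
                ((summable_nat_add_iff N).2 hg.summable)
              simp only [hr, hh]
              rw [← Real.exp_nat_mul, Real.exp_le_exp]
              have hm : s ^ (-c) ≤ ((k + N : ℕ) : ℝ) := by
                have := (Nat.lt_floor_add_one (s ^ (-c))).le
                rw [hN]; push_cast
                have hk0 : (0 : ℝ) ≤ k := by positivity
                have hK0 : (0 : ℝ) ≤ K := by positivity
                linarith
              generalize hm' : k + N = m at hm
              have h5 := hK m (by omega)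
              have hlog : c * -Real.log s ≤ Real.log m := by
                have := Real.log_le_log (by positivity) hm
                rw [Real.log_rpow hs0] at this
                linarith
              have h6 : c * (m * (c * -Real.log s)) ≤ θ m := le_trans (by gcongr) h5
              have := mul_le_mul_of_nonneg_left h6 hs0.le
              linarith
          _ ≤ ∑' k, r s ^ k := by
              rw [← hg.summable.sum_add_tsum_nat_add N]
              have : 0 ≤ ∑ k ∈ Finset.range N, r s ^ k :=
                Finset.sum_nonneg fun _ _ => by positivity
              linarith
      linarith
    calc h s * expSum θ s ≤ h s * (N + (1 - r s)⁻¹) := by gcongr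
      _ = h s * N + h s / (1 - r s) := by ring
      _ ≤ _ := by gcongr

open Filter Topology in
theorem tendsto_mul_expSum {θ : ℕ → ℝ} (h2 : ∀ k : ℕ, (k + 1) * Real.log 2 ≤ θ k)
    (hθ : Tendsto (fun k : ℕ => θ k / (k * Real.log k)) atTop (𝓝 1)) :
    Tendsto (fun s => s * -Real.log s * expSum θ s) (𝓝[>] 0) (𝓝 1) := by
  have hpos : ∀ᶠ k : ℕ in atTop, (0 : ℝ) < k * Real.log k := by
    filter_upwards [eventually_ge_atTop 2] with k hk
    have : (1 : ℝ) < k := by exact_mod_cast hk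
    exact mul_pos (by linarith) (Real.log_pos this)
  refine tendsto_order.2 ⟨fun a ha => ?_, fun a ha => ?_⟩
  · obtain ⟨c, hc, hac⟩ : ∃ c : ℝ, 1 < c ∧ a < c⁻¹ := by
      have h1 : Tendsto (fun c : ℝ => c⁻¹) (𝓝[>] 1) (𝓝 1) := by
        simpa using (tendsto_inv₀ (one_ne_zero (α := ℝ))).mono_left nhdsWithin_le_nhds
      obtain ⟨c, hc1, hc2⟩ := ((h1.eventually_const_lt ha).and self_mem_nhdsWithin).exists
      exact ⟨c, hc2, hc1⟩
    obtain ⟨g, hg, hle⟩ := exists_tendsto_le_mul_expSum h2 (zero_lt_one.trans hc) (by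
      filter_upwards [hθ.eventually_lt_const hc, hpos] with k hk hk0
      exact ((div_lt_iff₀ hk0).1 hk).le)
    filter_upwards [hg.eventually_const_lt hac, hle] with s h3 h4 using h3.trans_le h4
  · obtain ⟨c, hc0, hc, hac⟩ : ∃ c : ℝ, 0 < c ∧ c < 1 ∧ (c ^ 2)⁻¹ < a := by
      have h1 : Tendsto (fun c : ℝ => (c ^ 2)⁻¹) (𝓝[<] 1) (𝓝 1) := by
        have : ContinuousAt (fun c : ℝ => (c ^ 2)⁻¹) 1 := by
          refine ContinuousAt.inv₀ (by fun_prop) (by norm_num)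
        simpa using this.tendsto.mono_left (nhdsWithin_le_nhds (s := Set.Iio 1))
      obtain ⟨c, hc1, hc2⟩ := ((h1.eventually_lt_const ha).and
        (Ioo_mem_nhdsLT (show (0 : ℝ) < 1 by norm_num))).exists
      exact ⟨c, hc2.1, hc2.2, hc1⟩
    obtain ⟨g, hg, hle⟩ := exists_tendsto_mul_expSum_le h2 hc0 hc (by
      filter_upwards [hθ.eventually_const_lt hc, hpos] with k hk hk0
      exact ((lt_div_iff₀ hk0).1 hk).le)
    filter_upwards [hg.eventually_lt_const hac, hle] with s h3 h4 using h4.trans_lt h3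

-- A bound uniform in all `t > 0`, used as the majorant for dominated convergence. The factor `1 +
-- max (-log t) 0` stands for `log (1/t)` near `0` and stays positive elsewhere.
open Filter Topology in
theorem exists_mul_expSum_mul_le {θ : ℕ → ℝ} (h2 : ∀ k : ℕ, (k + 1) * Real.log 2 ≤ θ k)
    (hθ : Tendsto (fun k : ℕ => θ k / (k * Real.log k)) atTop (𝓝 1)) :
    ∃ C, 0 ≤ C ∧ ∀ t : ℝ, 0 < t → t * expSum θ t * (1 + max (-Real.log t) 0) ≤ C := by
  have h := tendsto_mul_expSum h2 hθ
  have hev := (h.eventually_lt_const (show (1 : ℝ) < 2 by norm_num)).and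
    (tendsto_neg_log_nhdsGT_zero.eventually_ge_atTop 1)
  obtain ⟨t₀, ht₀, hlt⟩ := (mem_nhdsGT_iff_exists_Ioo_subset).1 hev
  have ht₀' : 0 < t₀ := ht₀
  have hl := Real.log_pos (show (1 : ℝ) < 2 by norm_num)
  refine ⟨4 + (Real.log 2)⁻¹ * (1 + max (-Real.log t₀) 0), by positivity, fun t ht => ?_⟩
  have hS := expSum_nonneg θ t
  rcases lt_or_ge t t₀ with h1 | h1
  · obtain ⟨h3, h4⟩ := hlt ⟨ht, h1⟩
    rw [max_eq_left (by linarith)]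
    have h5 : t * expSum θ t ≤ t * expSum θ t * -Real.log t :=
      le_mul_of_one_le_right (by positivity) h4
    have h6 : 0 ≤ (Real.log 2)⁻¹ * (1 + max (-Real.log t₀) 0) := by positivity
    nlinarith
  · have h3 := mul_expSum_le h2 ht
    have h4 : -Real.log t ≤ -Real.log t₀ := neg_le_neg (Real.log_le_log ht₀' h1)
    calc _ ≤ (Real.log 2)⁻¹ * (1 + max (-Real.log t₀) 0) := by gcongr
      _ ≤ _ := by linarith

/-! ### Asymptotics of the partition generating function -/

/-- The logarithm of the generating function of the partitions with parts `θ k`. -/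
noncomputable def partitionLog (θ : ℕ → ℝ) (s : ℝ) : ℝ :=
  ∑' k, -Real.log (1 - Real.exp (-(s * θ k)))

theorem summable_neg_log_one_sub_exp {θ : ℕ → ℝ} (h2 : ∀ k : ℕ, (k + 1) * Real.log 2 ≤ θ k)
    {s : ℝ} (hs : 0 < s) : Summable fun k => -Real.log (1 - Real.exp (-(s * θ k))) := by
  set x := Real.exp (-(s * Real.log 2)) with hx
  have hx1 : x < 1 := exp_neg_mul_log_two_lt_one hs
  have hx0 : 0 < x := Real.exp_pos _
  have hle (k : ℕ) : Real.exp (-(s * θ k)) ≤ x :=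
    (expSum_term_le h2 hs k).trans (pow_le_of_le_one hx0.le hx1.le (by omega))
  refine Summable.of_nonneg_of_le (fun k => ?_) (fun k => ?_)
    ((summable_exp_neg_mul h2 hs).mul_right (1 - x)⁻¹)
  · have := Real.exp_pos (-(s * θ k))
    exact neg_nonneg.2 (Real.log_nonpos (by linarith [hle k]) (by linarith))
  · have h0 := Real.exp_pos (-(s * θ k))
    have h1 : 0 < 1 - Real.exp (-(s * θ k)) := by linarith [hle k]
    have h3 := Real.log_le_sub_one_of_pos (inv_pos.2 h1)
    rw [Real.log_inv] at h3
    calc _ ≤ (1 - Real.exp (-(s * θ k)))⁻¹ - 1 := h3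
      _ = Real.exp (-(s * θ k)) * (1 - Real.exp (-(s * θ k)))⁻¹ := by field_simp; ring
      _ ≤ _ := by
        have : 0 < 1 - x := by linarith
        gcongr
        exact hle k

theorem partitionLog_eq_tsum_expSum {θ : ℕ → ℝ} (h2 : ∀ k : ℕ, (k + 1) * Real.log 2 ≤ θ k)
    {s : ℝ} (hs : 0 < s) :
    partitionLog θ s = ∑' r : ℕ, expSum θ ((r + 1) * s) / (r + 1) := by
  have hl := Real.log_pos (show (1 : ℝ) < 2 by norm_num)
  have hθ (k : ℕ) : 0 < θ k := lt_of_lt_of_le (by positivity) (h2 k)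
  have hsum (k : ℕ) : HasSum (fun r : ℕ => Real.exp (-(s * θ k)) ^ (r + 1) / (r + 1))
      (-Real.log (1 - Real.exp (-(s * θ k)))) := by
    refine Real.hasSum_pow_div_log_of_abs_lt_one ?_
    rw [abs_of_pos (Real.exp_pos _), Real.exp_lt_one_iff]
    have := mul_pos hs (hθ k)
    linarith
  have hprod : Summable (Function.uncurry fun (k r : ℕ) =>
      Real.exp (-(s * θ k)) ^ (r + 1) / ((r : ℝ) + 1)) := by
    refine (summable_prod_of_nonneg fun p => ?_).2 ⟨fun k => (hsum k).summable, ?_⟩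
    · simp only [Function.uncurry, Pi.zero_apply]; positivity
    · refine (summable_neg_log_one_sub_exp h2 hs).congr fun k => ?_
      exact (hsum k).tsum_eq.symm
  rw [partitionLog]
  calc _ = ∑' k, ∑' r : ℕ, Real.exp (-(s * θ k)) ^ (r + 1) / ((r : ℝ) + 1) :=
        tsum_congr fun k => (hsum k).tsum_eq.symm
    _ = ∑' r : ℕ, ∑' k, Real.exp (-(s * θ k)) ^ (r + 1) / ((r : ℝ) + 1) := hprod.tsum_comm.symm
    _ = _ := by
      refine tsum_congr fun r => ?_
      rw [tsum_div_const, expSum]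
      congr 1
      refine tsum_congr fun k => ?_
      rw [← Real.exp_nat_mul]
      congr 1
      push_cast
      ring

open Filter Topology in
theorem tendsto_log_div_log_mul {c : ℝ} (hc : 0 < c) :
    Tendsto (fun s : ℝ => -Real.log s / -Real.log (c * s)) (𝓝[>] 0) (𝓝 1) := by
  have h0 := tendsto_neg_log_nhdsGT_zero
  have h1 : Tendsto (fun s : ℝ => (1 - Real.log c / -Real.log s)⁻¹) (𝓝[>] 0) (𝓝 1) := by
    have := ((tendsto_const_nhds (x := Real.log c)).div_atTop h0).const_sub 1
    rw [sub_zero] at this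
    simpa using this.inv₀ one_ne_zero
  refine h1.congr' ?_
  filter_upwards [h0.eventually_gt_atTop 0, self_mem_nhdsWithin] with s hs (hs0 : 0 < s)
  have h2 : 1 - Real.log c / -Real.log s = -(Real.log c + Real.log s) / -Real.log s := by
    rw [eq_div_iff hs.ne', sub_mul, div_mul_cancel₀ _ hs.ne']
    ring
  rw [Real.log_mul hc.ne' hs0.ne', h2, inv_div]

open Filter Topology in
theorem tendsto_const_mul_nhdsGT_zero {c : ℝ} (hc : 0 < c) :
    Tendsto (fun s : ℝ => c * s) (𝓝[>] 0) (𝓝[>] 0) := by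
  refine tendsto_nhdsWithin_iff.2 ⟨?_, ?_⟩
  · have : Continuous fun s : ℝ => c * s := by fun_prop
    simpa using (this.tendsto 0).mono_left (nhdsWithin_le_nhds (s := Set.Ioi 0))
  · filter_upwards [self_mem_nhdsWithin] with s (hs : 0 < s) using mul_pos hc hs

theorem one_add_log_le_two_mul_sqrt {x : ℝ} (hx : 1 ≤ x) : 1 + Real.log x ≤ 2 * √x := by
  have h := Real.log_le_sub_one_of_pos (Real.sqrt_pos.2 (by linarith : 0 < x))
  rw [Real.log_sqrt (by linarith)] at h
  linarith

-- In the expansion over `r`, the `r`-th normalized term tends to `1/(r+1)²`, and these limits sum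
-- to `ζ(2) = π²/6`. Dominated convergence justifies the interchange.
open Filter Topology in
theorem tendsto_mul_partitionLog {θ : ℕ → ℝ} (h2 : ∀ k : ℕ, (k + 1) * Real.log 2 ≤ θ k)
    (hθ : Tendsto (fun k : ℕ => θ k / (k * Real.log k)) atTop (𝓝 1)) :
    Tendsto (fun s => s * -Real.log s * partitionLog θ s) (𝓝[>] 0) (𝓝 (Real.pi ^ 2 / 6)) := by
  obtain ⟨C, hC0, hC⟩ := exists_mul_expSum_mul_le h2 hθ
  have hz : ∑' r : ℕ, 1 / ((r : ℝ) + 1) ^ 2 = Real.pi ^ 2 / 6 := by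
    have := hasSum_zeta_two
    rw [← this.tsum_eq, this.summable.tsum_eq_zero_add]
    simp
  rw [← hz]
  have hbound : Summable fun r : ℕ => 2 * C * (1 / ((r : ℝ) + 1) ^ (3 / 2 : ℝ)) := by
    refine Summable.mul_left _ ?_
    have := (summable_nat_add_iff 1).2 (Real.summable_one_div_nat_rpow.2
      (show (1 : ℝ) < 3 / 2 by norm_num))
    simpa using this
  have key : Tendsto (fun s => ∑' r : ℕ, s * -Real.log s * (expSum θ ((r + 1) * s) / (r + 1)))
      (𝓝[>] 0) (𝓝 (∑' r : ℕ, 1 / ((r : ℝ) + 1) ^ 2)) := by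
    refine tendsto_tsum_of_dominated_convergence hbound (fun r => ?_) ?_
    · have hr : (0 : ℝ) < r + 1 := by positivity
      have e1 := ((tendsto_mul_expSum h2 hθ).comp (tendsto_const_mul_nhdsGT_zero hr)).mul
        (tendsto_log_div_log_mul hr)
      have e2 := e1.div_const (((r : ℝ) + 1) ^ 2)
      rw [one_mul] at e2
      refine e2.congr' ?_
      filter_upwards [(tendsto_neg_log_nhdsGT_zero.comp
        (tendsto_const_mul_nhdsGT_zero hr)).eventually_gt_atTop 0] with s hs
      simp only [Function.comp_apply] at hs ⊢
      have hne : Real.log ((r + 1) * s) ≠ 0 := by intro h; simp [h] at hs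
      field_simp
    · filter_upwards [Ioo_mem_nhdsGT (show (0 : ℝ) < 1 by norm_num)] with s hs r
      have hs0 := hs.1
      have hL : 0 < -Real.log s := neg_pos.2 (Real.log_neg hs.1 hs.2)
      have hr : (0 : ℝ) < r + 1 := by positivity
      have hr1 : (1 : ℝ) ≤ r + 1 := by have : (0 : ℝ) ≤ r := by positivity
                                       linarith
      have hlr : 0 ≤ Real.log ((r : ℝ) + 1) := Real.log_nonneg hr1
      have hS := expSum_nonneg θ ((r + 1) * s)
      rw [Real.norm_of_nonneg (by positivity)]
      have h3 := hC ((r + 1) * s) (by positivity)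
      set M := max (-Real.log ((r + 1) * s)) 0 with hM
      have hM0 : 0 ≤ M := le_max_right _ _
      -- Passing from `log (1/s)` to `log (1/((r+1)s))` costs a factor `1 + log (r+1) ≤ 2√(r+1)`, so
      -- the majorant decays like `(r+1)^(-3/2)` and is still summable.
      have hLM : -Real.log s ≤ (1 + Real.log ((r : ℝ) + 1)) * (1 + M) := by
        have : -Real.log ((r + 1) * s) ≤ M := le_max_left _ _
        rw [Real.log_mul hr.ne' hs0.ne'] at this
        nlinarith [mul_nonneg hlr hM0]
      have h4 := one_add_log_le_two_mul_sqrt hr1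
      have h5 : s * -Real.log s * (expSum θ ((r + 1) * s) / (r + 1)) =
          ((r + 1) * s * expSum θ ((r + 1) * s)) * -Real.log s / ((r : ℝ) + 1) ^ 2 := by
        field_simp
      have h6 : ((r : ℝ) + 1) ^ 2 = ((r : ℝ) + 1) ^ (3 / 2 : ℝ) * √((r : ℝ) + 1) := by
        rw [Real.sqrt_eq_rpow, ← Real.rpow_add hr]; norm_num
      rw [h5, div_le_iff₀ (by positivity), h6]
      calc _ ≤ ((r + 1) * s * expSum θ ((r + 1) * s)) *
            ((1 + Real.log ((r : ℝ) + 1)) * (1 + M)) := by gcongr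
        _ = ((r + 1) * s * expSum θ ((r + 1) * s) * (1 + M)) * (1 + Real.log ((r : ℝ) + 1)) := by
            ring
        _ ≤ C * (2 * √((r : ℝ) + 1)) := by gcongr
        _ = _ := by field_simp
  refine key.congr' ?_
  filter_upwards [self_mem_nhdsWithin] with s (hs : 0 < s)
  rw [partitionLog_eq_tsum_expSum h2 hs, tsum_mul_left]

/-! ### Growth of the logarithms of primorials -/

/-- `θ(p_k)`, the logarithm of the product of the primes up to the `k`-th one (from `k = 0`). -/
noncomputable def logPrimorial (k : ℕ) : ℝ := Real.log (primorial (Nat.nth Nat.Prime k))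

theorem primorial_nth_prime (k : ℕ) :
    primorial (Nat.nth Nat.Prime k) = ∏ i ∈ Finset.range (k + 1), Nat.nth Nat.Prime i := by
  have : (Finset.range (Nat.nth Nat.Prime k + 1)).filter Nat.Prime =
      (Finset.range (k + 1)).image (Nat.nth Nat.Prime) := by
    ext q
    simp only [Finset.mem_filter, Finset.mem_range, Finset.mem_image, Nat.lt_succ_iff]
    constructor
    · rintro ⟨h1, h2⟩
      refine ⟨Nat.count Nat.Prime q, ?_, Nat.nth_count h2⟩
      rwa [← Nat.nth_le_nth Nat.infinite_setOfPred_prime, Nat.nth_count h2]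
    · rintro ⟨i, hi, rfl⟩
      exact ⟨Nat.nth_monotone Nat.infinite_setOfPred_prime hi, Nat.prime_nth_prime i⟩
  rw [primorial, this, Finset.prod_image ((Nat.nth_injective Nat.infinite_setOfPred_prime).injOn)]

theorem succ_mul_log_two_le_logPrimorial (k : ℕ) : (k + 1) * Real.log 2 ≤ logPrimorial k := by
  have h : 2 ^ (k + 1) ≤ primorial (Nat.nth Nat.Prime k) := by
    rw [primorial_nth_prime]
    calc 2 ^ (k + 1) = ∏ _i ∈ Finset.range (k + 1), 2 := by simp
      _ ≤ _ := Finset.prod_le_prod' fun i _ => (Nat.prime_nth_prime i).two_le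
  have h' : (2 : ℝ) ^ (k + 1) ≤ primorial (Nat.nth Nat.Prime k) := by exact_mod_cast h
  have := Real.log_le_log (by positivity) h'
  rw [Real.log_pow] at this
  rw [logPrimorial]
  exact_mod_cast this

/-- The `i`-th prime exceeds `i + 1`, so the primorial is at least `(k+1)!`; then `k^k / k! ≤ e^k`.
-/
theorem mul_log_sub_le_logPrimorial (k : ℕ) : k * Real.log k - k ≤ logPrimorial k := by
  have h : (k + 1).factorial ≤ primorial (Nat.nth Nat.Prime k) := by
    rw [primorial_nth_prime, ← Finset.prod_range_add_one_eq_factorial]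
    exact Finset.prod_le_prod' fun i _ => by have := Nat.add_two_le_nth_prime i; omega
  have h' : ((k.factorial : ℕ) : ℝ) ≤ primorial (Nat.nth Nat.Prime k) := by
    exact_mod_cast (Nat.factorial_le (Nat.le_succ k)).trans h
  have h2 := Real.log_le_log (by exact_mod_cast k.factorial_pos) h'
  have h3 : k * Real.log k - k ≤ Real.log (k.factorial : ℝ) := by
    rcases Nat.eq_zero_or_pos k with rfl | hk
    · simp
    have hk' : (0 : ℝ) < k := by exact_mod_cast hk
    have h4 := Real.pow_div_factorial_le_exp (k : ℝ) hk'.le k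
    rw [div_le_iff₀ (by positivity)] at h4
    have h5 := Real.log_le_log (by positivity) h4
    rw [Real.log_mul (Real.exp_pos _).ne' (by positivity), Real.log_exp, Real.log_pow] at h5
    linarith
  exact h3.trans h2

-- Chebyshev's lower bound gives `p / 4 ≤ (k+1) log p` for the prime `p` of index `k`. Absorbing `4
-- log p` into `p^(1-1/c)` leaves `p^(1/c) ≤ k + 1`.
open Filter Topology in
theorem eventually_log_nth_prime_le {c : ℝ} (hc : 1 < c) :
    ∀ᶠ k : ℕ in atTop, Real.log (Nat.nth Nat.Prime k) ≤ c * Real.log (k + 1) := by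
  have hlog : ∀ᶠ x : ℝ in atTop, 4 * Real.log x ≤ x ^ (1 - c⁻¹) ∧ 8 * Real.log x ≤ x := by
    have hc' : 0 < 1 - c⁻¹ := by rw [sub_pos]; exact inv_lt_one_of_one_lt₀ hc
    have h1 := (isLittleO_log_rpow_atTop hc').bound (show (0 : ℝ) < 1 / 4 by norm_num)
    have h2 := (isLittleO_log_rpow_atTop one_pos).bound (show (0 : ℝ) < 1 / 8 by norm_num)
    filter_upwards [h1, h2, eventually_ge_atTop 1] with x h1 h2 hx
    rw [Real.rpow_one] at h2
    rw [Real.norm_of_nonneg (Real.log_nonneg hx), Real.norm_of_nonneg (by positivity)] at h1 h2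
    exact ⟨by linarith, by linarith⟩
  have hp : Tendsto (fun k : ℕ => (Nat.nth Nat.Prime k : ℝ)) atTop atTop :=
    tendsto_natCast_atTop_atTop.comp
      (Nat.nth_strictMono Nat.infinite_setOfPred_prime).tendsto_atTop
  filter_upwards [hp.eventually hlog] with k hk
  set p := Nat.nth Nat.Prime k with hpk
  have hp2 : (2 : ℝ) ≤ p := by exact_mod_cast (Nat.prime_nth_prime k).two_le
  have hp0 : (0 : ℝ) < p := by linarith
  have hlp : 0 < Real.log p := Real.log_pos (by linarith)
  have hpi : Nat.primeCounting p = k + 1 := by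
    rw [Nat.primeCounting_eq_primeCounting'_succ, Nat.primeCounting', Nat.count_succ,
      if_pos (Nat.prime_nth_prime k), ← Nat.primeCounting'_nth_eq k, Nat.primeCounting']
  have h1 := Chebyshev.pi_ge p
  rw [hpi, div_le_iff₀ hlp] at h1
  push_cast at h1
  have hl2 := Real.log_two_gt_d9
  have h3 : Real.log (p + 1) ≤ 2 * Real.log p := by
    rw [← Real.log_rpow hp0 2]
    refine Real.log_le_log (by positivity) ?_
    norm_num
    nlinarith
  have h4 : (p : ℝ) / 4 ≤ (k + 1) * Real.log p := by nlinarith [hk.2]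
  have h5 : (p : ℝ) ^ c⁻¹ ≤ k + 1 := by
    have h6 : (p : ℝ) ^ c⁻¹ * p ^ (1 - c⁻¹) = p := by
      rw [← Real.rpow_add hp0]; simp
    have h7 : (p : ℝ) ^ c⁻¹ * (4 * Real.log p) ≤ (k + 1) * (4 * Real.log p) := by
      calc _ ≤ (p : ℝ) ^ c⁻¹ * p ^ (1 - c⁻¹) := by gcongr; exact hk.1
        _ ≤ _ := by rw [h6]; linarith
    exact le_of_mul_le_mul_right h7 (by positivity)
  have h8 := Real.log_le_log (by positivity) h5
  rw [Real.log_rpow hp0, inv_mul_le_iff₀ (by linarith)] at h8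
  exact h8

theorem logPrimorial_le (k : ℕ) :
    logPrimorial k ≤ (k + 1) * Real.log (Nat.nth Nat.Prime k) := by
  have h : primorial (Nat.nth Nat.Prime k) ≤ Nat.nth Nat.Prime k ^ (k + 1) := by
    rw [primorial_nth_prime]
    calc _ ≤ ∏ _i ∈ Finset.range (k + 1), Nat.nth Nat.Prime k :=
          Finset.prod_le_prod' fun i hi =>
            Nat.nth_monotone Nat.infinite_setOfPred_prime (by simp at hi; omega)
      _ = _ := by simp
  have h' : (primorial (Nat.nth Nat.Prime k) : ℝ) ≤ (Nat.nth Nat.Prime k : ℝ) ^ (k + 1) := by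
    exact_mod_cast h
  have := Real.log_le_log (by exact_mod_cast primorial_pos _) h'
  rw [Real.log_pow] at this
  rw [logPrimorial]
  exact_mod_cast this

-- Chebyshev's estimate suffices in place of the prime number theorem: only `log p_k ~ log k`
-- enters, through `primorial ≤ p_k^(k+1)`, while the factorial gives the lower bound.
open Filter Topology in
theorem tendsto_logPrimorial_div :
    Tendsto (fun k : ℕ => logPrimorial k / (k * Real.log k)) atTop (𝓝 1) := by
  have hlog : Tendsto (fun k : ℕ => Real.log (k : ℝ)) atTop atTop :=
    Real.tendsto_log_atTop.comp tendsto_natCast_atTop_atTop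
  have hpos : ∀ᶠ k : ℕ in atTop, 0 < (k : ℝ) ∧ 0 < Real.log (k : ℝ) := by
    filter_upwards [eventually_ge_atTop 2] with k hk
    have : (1 : ℝ) < k := by exact_mod_cast hk
    exact ⟨by linarith, Real.log_pos this⟩
  refine tendsto_order.2 ⟨fun a ha => ?_, fun a ha => ?_⟩
  · have h1 : Tendsto (fun k : ℕ => 1 - 1 / Real.log (k : ℝ)) atTop (𝓝 1) := by
      simpa using (hlog.const_div_atTop 1).const_sub 1
    filter_upwards [h1.eventually_const_lt ha, hpos] with k hk hk0
    refine hk.trans_le ?_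
    rw [le_div_iff₀ (mul_pos hk0.1 hk0.2)]
    refine le_trans (le_of_eq ?_) (mul_log_sub_le_logPrimorial k)
    have := hk0.2.ne'
    field_simp
  · obtain ⟨c, hc, hca⟩ := exists_between ha
    have h1 : Tendsto (fun k : ℕ => (1 + 1 / (k : ℝ)) * (c * (1 + 1 / Real.log (k : ℝ)))) atTop
        (𝓝 c) := by
      have e1 : Tendsto (fun k : ℕ => 1 + 1 / (k : ℝ)) atTop (𝓝 1) := by
        simpa using (tendsto_natCast_atTop_atTop.const_div_atTop (1 : ℝ)).const_add 1
      have e2 : Tendsto (fun k : ℕ => 1 + 1 / Real.log (k : ℝ)) atTop (𝓝 1) := by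
        simpa using (hlog.const_div_atTop 1).const_add 1
      simpa using e1.mul (e2.const_mul c)
    filter_upwards [h1.eventually_lt_const hca, hpos, eventually_log_nth_prime_le hc,
      eventually_ge_atTop 1] with k hk hk0 hk1 hk2
    refine lt_of_le_of_lt ?_ hk
    obtain ⟨hk3, hk4⟩ := hk0
    have hk2' : (1 : ℝ) ≤ k := by exact_mod_cast hk2
    have h5 : Real.log (k + 1) ≤ Real.log k + 1 := by
      have h6 := Real.log_le_sub_one_of_pos (show 0 < ((k : ℝ) + 1) / k by positivity)
      rw [Real.log_div (by positivity) hk3.ne'] at h6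
      have : ((k : ℝ) + 1) / k ≤ 2 := by rw [div_le_iff₀ hk3]; linarith
      linarith
    rw [div_le_iff₀ (mul_pos hk3 hk4)]
    calc _ ≤ (k + 1) * Real.log (Nat.nth Nat.Prime k) := logPrimorial_le k
      _ ≤ (k + 1) * (c * (Real.log k + 1)) := by
        gcongr
        exact hk1.trans (by gcongr)
      _ = _ := by field_simp

/-! ### Hardy–Ramanujan integers as products of primorials -/

/-- The completely multiplicative map sending each prime `p` to the primorial of `p`. -/
def primorialHom : ℕ →*₀ ℕ where
  toFun n := if n = 0 then 0 else n.factorization.prod fun p k => primorial p ^ k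
  map_zero' := by simp
  map_one' := by simp
  map_mul' a b := by
    by_cases ha : a = 0
    · simp [ha]
    by_cases hb : b = 0
    · simp [hb]
    simp only [ha, hb, mul_eq_zero, or_self, if_false]
    rw [Nat.factorization_mul ha hb, Finsupp.prod_add_index' (by simp) fun _ _ _ => pow_add _ _ _]

theorem primorialHom_prime {p : ℕ} (hp : p.Prime) : primorialHom p = primorial p := by
  change (if p = 0 then 0 else p.factorization.prod fun p k => primorial p ^ k) = _
  rw [if_neg hp.ne_zero, hp.factorization, Finsupp.prod_single_index (by simp), pow_one]

theorem primorialHom_pos {n : ℕ} (hn : n ≠ 0) : 0 < primorialHom n := by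
  change 0 < (if n = 0 then 0 else n.factorization.prod fun p k => primorial p ^ k)
  rw [if_neg hn]
  exact Finset.prod_pos fun p _ => pow_pos (primorial_pos p) _

theorem factorization_primorial_nth_prime (k i : ℕ) :
    (primorial (Nat.nth Nat.Prime k)).factorization (Nat.nth Nat.Prime i) =
      if i ≤ k then 1 else 0 := by
  have := factorization_prod_range_nth_prime 1 (fun _ => k + 1) i
  rw [Finset.prod_range_one, ← primorial_nth_prime] at this
  rw [this]
  split_ifs with h
  · rw [Finset.filter_true_of_mem fun _ _ => by omega, Finset.card_range]
  · rw [Finset.filter_false_of_mem fun _ _ => by omega, Finset.card_empty]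

/-- Only the primorial of the `i`-th prime contains the `i`-th prime but not the next. The exponents
of `n` are thus the consecutive differences of those of its image, which yields monotonicity,
injectivity and surjectivity. -/
theorem factorization_primorialHom {n : ℕ} (hn : n ≠ 0) (i : ℕ) :
    (primorialHom n).factorization (Nat.nth Nat.Prime i) =
      (primorialHom n).factorization (Nat.nth Nat.Prime (i + 1)) +
        n.factorization (Nat.nth Nat.Prime i) := by
  induction n using induction_on_primes with
  | zero => exact absurd rfl hn
  | one => simp
  | prime_mul p a hp ih =>
    have ha : a ≠ 0 := fun h => hn (by simp [h])
    have hpp := primorialHom_pos hp.ne_zero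
    rw [map_mul, Nat.factorization_mul hpp.ne' (primorialHom_pos ha).ne',
      Nat.factorization_mul hp.ne_zero ha, Finsupp.add_apply, Finsupp.add_apply,
      Finsupp.add_apply, ih ha, primorialHom_prime hp]
    obtain ⟨k, rfl⟩ := exists_nth_prime_eq hp
    rw [factorization_primorial_nth_prime, factorization_primorial_nth_prime, hp.factorization,
      Finsupp.single_apply]
    simp only [(Nat.nth_injective Nat.infinite_setOfPred_prime).eq_iff]
    split_ifs <;> omega

theorem primorialHom_injOn : Set.InjOn primorialHom {n | n ≠ 0} := by
  intro a ha b hb hab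
  refine eq_of_factorization_nth_prime_eq ha hb fun i => ?_
  have h1 := factorization_primorialHom ha i
  have h2 := factorization_primorialHom hb i
  rw [hab] at h1
  omega

theorem isHardyRamanujan_primorialHom {n : ℕ} (hn : n ≠ 0) :
    IsHardyRamanujan (primorialHom n) :=
  isHardyRamanujan_iff.2 ⟨(primorialHom_pos hn).ne', antitone_nat_of_succ_le fun i => by
    rw [factorization_primorialHom hn i]; exact Nat.le_add_right _ _⟩

theorem IsHardyRamanujan.exists_primorialHom_eq {m : ℕ} (h : IsHardyRamanujan m) :
    ∃ n, n ≠ 0 ∧ primorialHom n = m := by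
  obtain ⟨hm, hanti⟩ := isHardyRamanujan_iff.1 h
  set v : ℕ → ℕ := fun i => m.factorization (Nat.nth Nat.Prime i) with hv
  set n := ∏ i : Fin m, Nat.nth Nat.Prime (i : ℕ) ^ (v i - v (i + 1)) with hn
  have hn0 : n ≠ 0 :=
    Finset.prod_ne_zero_iff.2 fun i _ => pow_ne_zero _ (Nat.prime_nth_prime _).ne_zero
  have hvn (j : ℕ) : n.factorization (Nat.nth Nat.Prime j) = v j - v (j + 1) := by
    rw [hn, factorization_prod_nth_prime (fun i : Fin m => v i - v (i + 1))]
    split_ifs with hj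
    · rfl
    · have : v j = 0 := factorization_nth_prime_eq_zero (by omega)
      omega
  refine ⟨n, hn0, eq_of_factorization_nth_prime_eq (primorialHom_pos hn0).ne' hm ?_⟩
  -- Descending induction on `i`, starting where the index is so large that both exponents vanish.
  have key (d : ℕ) : ∀ i, primorialHom n + m ≤ i + d →
      (primorialHom n).factorization (Nat.nth Nat.Prime i) = v i := by
    induction d with
    | zero =>
      intro i hi
      have h1 : v i = 0 := factorization_nth_prime_eq_zero (by omega)
      rw [h1]
      exact factorization_nth_prime_eq_zero (by omega)
    | succ d ih =>
      intro i hi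
      have h1 : v (i + 1) ≤ v i := hanti (Nat.le_succ i)
      rw [factorization_primorialHom hn0, hvn, ih (i + 1) (by omega)]
      omega
  exact fun j => key _ j (Nat.le_add_left _ _)

theorem hardyRamanujanCount_eq (x : ℝ) :
    hardyRamanujanCount x = Set.ncard {n : ℕ | n ≠ 0 ∧ (primorialHom n : ℝ) ≤ x} := by
  have : {n : ℕ | IsHardyRamanujan n ∧ (n : ℝ) ≤ x} =
      primorialHom '' {n : ℕ | n ≠ 0 ∧ (primorialHom n : ℝ) ≤ x} := by
    ext m
    constructor
    · rintro ⟨h, hx⟩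
      obtain ⟨n, hn, rfl⟩ := h.exists_primorialHom_eq
      exact ⟨n, ⟨hn, hx⟩, rfl⟩
    · rintro ⟨n, ⟨hn, hx⟩, rfl⟩
      exact ⟨isHardyRamanujan_primorialHom hn, hx⟩
  rw [hardyRamanujanCount, this, (primorialHom_injOn.mono fun n hn => hn.1).ncard_image]

theorem finite_setOf_primorialHom_le (x : ℝ) :
    {n : ℕ | n ≠ 0 ∧ (primorialHom n : ℝ) ≤ x}.Finite := by
  refine Set.Finite.of_finite_image (f := primorialHom) ?_
    (primorialHom_injOn.mono fun n hn => hn.1)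
  refine (Set.finite_Iic ⌊x⌋₊).subset ?_
  rintro _ ⟨n, hn, rfl⟩
  exact Nat.le_floor hn.2

/-! ### The Dirichlet series and its Euler product -/

/-- The completely multiplicative function `n ↦ (primorialHom n) ^ (-s)`. -/
noncomputable def primorialRpow (s : ℝ) (hs : 0 < s) : ℕ →*₀ ℝ where
  toFun n := (primorialHom n : ℝ) ^ (-s)
  map_zero' := by simp [Real.zero_rpow (neg_ne_zero.2 hs.ne')]
  map_one' := by simp
  map_mul' a b := by
    rw [map_mul, Nat.cast_mul, Real.mul_rpow (Nat.cast_nonneg _) (Nat.cast_nonneg _)]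

theorem primorialRpow_apply {s : ℝ} (hs : 0 < s) (n : ℕ) :
    primorialRpow s hs n = (primorialHom n : ℝ) ^ (-s) := rfl

theorem primorialRpow_nonneg {s : ℝ} (hs : 0 < s) (n : ℕ) : 0 ≤ primorialRpow s hs n :=
  Real.rpow_nonneg (Nat.cast_nonneg _) _

theorem primorialRpow_nth_prime {s : ℝ} (hs : 0 < s) (k : ℕ) :
    primorialRpow s hs (Nat.nth Nat.Prime k) = Real.exp (-(s * logPrimorial k)) := by
  rw [primorialRpow_apply, primorialHom_prime (Nat.prime_nth_prime k),
    Real.rpow_def_of_pos (by exact_mod_cast primorial_pos _), logPrimorial]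
  ring_nf

theorem logPrimorial_pos (k : ℕ) : 0 < logPrimorial k :=
  lt_of_lt_of_le (mul_pos (by positivity) (Real.log_pos (by norm_num)))
    (succ_mul_log_two_le_logPrimorial k)

theorem primorialRpow_prime_lt_one {s : ℝ} (hs : 0 < s) {p : ℕ} (hp : p.Prime) :
    primorialRpow s hs p < 1 := by
  obtain ⟨k, rfl⟩ := exists_nth_prime_eq hp
  rw [primorialRpow_nth_prime, Real.exp_lt_one_iff]
  have := mul_pos hs (logPrimorial_pos k)
  linarith

theorem prod_inv_le_exp_partitionLog {s : ℝ} (hs : 0 < s) (S : Finset ℕ) :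
    ∏ k ∈ S, (1 - Real.exp (-(s * logPrimorial k)))⁻¹ ≤
      Real.exp (partitionLog logPrimorial s) := by
  have hlt (k : ℕ) : Real.exp (-(s * logPrimorial k)) < 1 := by
    rw [Real.exp_lt_one_iff]
    have := mul_pos hs (logPrimorial_pos k)
    linarith
  have h1 : ∏ k ∈ S, (1 - Real.exp (-(s * logPrimorial k)))⁻¹ =
      Real.exp (∑ k ∈ S, -Real.log (1 - Real.exp (-(s * logPrimorial k)))) := by
    rw [Real.exp_sum]
    refine Finset.prod_congr rfl fun k _ => ?_
    rw [← Real.log_inv, Real.exp_log (inv_pos.2 (by linarith [hlt k]))]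
  rw [h1, Real.exp_le_exp]
  refine (summable_neg_log_one_sub_exp succ_mul_log_two_le_logPrimorial hs).sum_le_tsum _
    fun k _ => ?_
  exact neg_nonneg.2 (Real.log_nonpos (by linarith [hlt k])
    (by linarith [Real.exp_pos (-(s * logPrimorial k))]))

/-- A finite set of integers is covered by the smooth numbers for some `N`, whose finite Euler
product is at most `exp (partitionLog logPrimorial s)`, independently of `N`. -/
theorem summable_primorialRpow {s : ℝ} (hs : 0 < s) : Summable (primorialRpow s hs) := by
  refine summable_of_sum_le (c := Real.exp (partitionLog logPrimorial s))
    (primorialRpow_nonneg hs) fun u => ?_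
  set N := u.sup id + 1 with hN
  obtain ⟨hsm, hhs⟩ := EulerProduct.summable_and_hasSum_smoothNumbers_prod_primesBelow_geometric
    (f := (primorialRpow s hs : ℕ →* ℝ)) (fun {p} hp => by
      have := primorialRpow_prime_lt_one hs hp
      exact (Real.norm_of_nonneg (primorialRpow_nonneg hs p)).trans_lt this) N
  have h1 : ∑ n ∈ u, primorialRpow s hs n ≤ ∏ p ∈ N.primesBelow, (1 - primorialRpow s hs p)⁻¹ := by
    have h2 : ∑ n ∈ u, primorialRpow s hs n = ∑ n ∈ u.erase 0, primorialRpow s hs n := by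
      rw [Finset.sum_erase _ (map_zero _)]
    have hmem : ∀ n ∈ u.erase 0, n ∈ N.smoothNumbers := fun n hn => by
      rw [Finset.mem_erase] at hn
      refine Nat.mem_smoothNumbers.2 ⟨hn.1, fun p hp => ?_⟩
      have h3 := Nat.le_of_dvd (Nat.pos_of_ne_zero hn.1) (Nat.dvd_of_mem_primeFactorsList hp)
      have h4 : n ≤ u.sup id := Finset.le_sup (f := id) hn.2
      omega
    rw [h2, ← Finset.sum_attach]
    let ι : {n // n ∈ u.erase 0} ↪ N.smoothNumbers := ⟨fun n => ⟨n.1, hmem n.1 n.2⟩,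
      fun a b hab => Subtype.ext (congrArg (fun m : N.smoothNumbers => (m : ℕ)) hab)⟩
    have h5 := sum_le_hasSum ((u.erase 0).attach.map ι)
      (fun n _ => primorialRpow_nonneg hs n.1) hhs
    rw [Finset.sum_map] at h5
    exact h5
  refine h1.trans ?_
  have h6 : N.primesBelow ⊆ (Finset.range N).image (Nat.nth Nat.Prime) := fun p hp => by
    obtain ⟨k, rfl⟩ := exists_nth_prime_eq (Nat.prime_of_mem_primesBelow hp)
    have h7 := Nat.lt_of_mem_primesBelow hp
    have := Nat.add_two_le_nth_prime k
    exact Finset.mem_image_of_mem _ (Finset.mem_range.2 (by omega))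
  calc _ ≤ ∏ p ∈ (Finset.range N).image (Nat.nth Nat.Prime), (1 - primorialRpow s hs p)⁻¹ := by
        refine Finset.prod_le_prod_of_subset_of_one_le h6 (fun p hp => ?_) fun p hp _ => ?_
        · have := primorialRpow_prime_lt_one hs (Nat.prime_of_mem_primesBelow hp)
          exact inv_nonneg.2 (by linarith)
        · obtain ⟨k, _, rfl⟩ := Finset.mem_image.1 hp
          have h8 := primorialRpow_prime_lt_one hs (Nat.prime_nth_prime k)
          have h9 := primorialRpow_nonneg hs (Nat.nth Nat.Prime k)
          exact (one_le_inv₀ (by linarith)).2 (by linarith)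
    _ = ∏ k ∈ Finset.range N, (1 - Real.exp (-(s * logPrimorial k)))⁻¹ := by
        rw [Finset.prod_image ((Nat.nth_injective Nat.infinite_setOfPred_prime).injOn)]
        exact Finset.prod_congr rfl fun k _ => by rw [primorialRpow_nth_prime]
    _ ≤ _ := prod_inv_le_exp_partitionLog hs _

/-- The sequence of primes as an enumeration of the subtype of primes. -/
noncomputable def nthPrimeEquiv : ℕ ≃ Nat.Primes :=
  Equiv.ofBijective (fun k => ⟨Nat.nth Nat.Prime k, Nat.prime_nth_prime k⟩)
    ⟨fun a b h => Nat.nth_injective Nat.infinite_setOfPred_prime (congrArg Subtype.val h),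
      fun p => by
        obtain ⟨k, hk⟩ := exists_nth_prime_eq p.2
        exact ⟨k, Subtype.ext hk⟩⟩

theorem tsum_primorialRpow {s : ℝ} (hs : 0 < s) :
    ∑' n, primorialRpow s hs n = Real.exp (partitionLog logPrimorial s) := by
  have h := EulerProduct.eulerProduct_completely_multiplicative_hasProd
    (f := primorialRpow s hs) (summable_primorialRpow hs).norm
  have h1 := (nthPrimeEquiv.hasProd_iff).2 h
  have h2 : HasProd (fun k => (1 - Real.exp (-(s * logPrimorial k)))⁻¹)
      (∑' n, primorialRpow s hs n) := by
    refine h1.congr_fun ?_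
    intro k
    rw [← primorialRpow_nth_prime hs]
    rfl
  have h3 := (summable_neg_log_one_sub_exp succ_mul_log_two_le_logPrimorial hs).hasSum.rexp
  refine h2.unique (h3.congr_fun fun k => ?_)
  have hlt : Real.exp (-(s * logPrimorial k)) < 1 := by
    rw [Real.exp_lt_one_iff]
    have := mul_pos hs (logPrimorial_pos k)
    linarith
  simp only [Function.comp_apply]
  rw [← Real.log_inv, Real.exp_log (inv_pos.2 (by linarith))]

/-! ### Bounding the count by the Dirichlet series -/

theorem hardyRamanujanCount_eq_card (x : ℝ) :
    hardyRamanujanCount x = (finite_setOf_primorialHom_le x).toFinset.card := by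
  rw [hardyRamanujanCount_eq, Set.ncard_eq_toFinset_card _ (finite_setOf_primorialHom_le x)]

theorem one_le_hardyRamanujanCount {u : ℝ} (hu : 0 ≤ u) :
    1 ≤ hardyRamanujanCount (Real.exp u) := by
  rw [hardyRamanujanCount_eq_card, Finset.one_le_card]
  exact ⟨1, (finite_setOf_primorialHom_le _).mem_toFinset.2 ⟨one_ne_zero, by simpa using hu⟩⟩

theorem primorialHom_eq_exp_log {n : ℕ} (hn : n ≠ 0) :
    Real.exp (Real.log (primorialHom n)) = primorialHom n :=
  Real.exp_log (by exact_mod_cast primorialHom_pos hn)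

theorem primorialRpow_eq_exp {s : ℝ} (hs : 0 < s) {n : ℕ} (hn : n ≠ 0) :
    primorialRpow s hs n = Real.exp (-(s * Real.log (primorialHom n))) := by
  rw [primorialRpow_apply, Real.rpow_def_of_pos (by exact_mod_cast primorialHom_pos hn)]
  ring_nf

/-- Rankin's trick: each counted term satisfies `1 ≤ e^(su) m^(-s)`. -/
theorem hardyRamanujanCount_exp_le {s : ℝ} (hs : 0 < s) (u : ℝ) :
    (hardyRamanujanCount (Real.exp u) : ℝ) ≤
      Real.exp (s * u + partitionLog logPrimorial s) := by
  rw [hardyRamanujanCount_eq_card, Real.exp_add, ← tsum_primorialRpow hs]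
  set T := (finite_setOf_primorialHom_le (Real.exp u)).toFinset with hT
  calc (T.card : ℝ) = ∑ n ∈ T, (1 : ℝ) := by simp
    _ ≤ ∑ n ∈ T, Real.exp (s * u) * primorialRpow s hs n := by
      refine Finset.sum_le_sum fun n hn => ?_
      obtain ⟨hn0, hnu⟩ := (finite_setOf_primorialHom_le (Real.exp u)).mem_toFinset.1 hn
      have hl : Real.log (primorialHom n) ≤ u := by
        rwa [← Real.exp_le_exp, primorialHom_eq_exp_log hn0]
      rw [primorialRpow_eq_exp hs hn0, ← Real.exp_add, Real.one_le_exp_iff]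
      have := mul_le_mul_of_nonneg_left hl hs.le
      linarith
    _ = Real.exp (s * u) * ∑ n ∈ T, primorialRpow s hs n := by rw [Finset.mul_sum]
    _ ≤ _ := by
      gcongr
      exact (summable_primorialRpow hs).sum_le_tsum _ fun n _ => primorialRpow_nonneg hs n

/-- The series is split by the size of `l = log m`. For `l ≤ a` the exponent is raised to `(1+η)s`,
for `l > b` it is lowered to `(1-η)s`, and each middle term is at most `e^(-sa)`. -/
theorem exp_partitionLog_le {s η : ℝ} (hs : 0 < s) (hη : 0 < η) (hη1 : η < 1) (a b : ℝ) :
    Real.exp (partitionLog logPrimorial s) ≤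
      Real.exp (η * s * a + partitionLog logPrimorial ((1 + η) * s)) +
      Real.exp (-(η * s * b) + partitionLog logPrimorial ((1 - η) * s)) +
      Real.exp (-(s * a)) * hardyRamanujanCount (Real.exp b) := by
  have hp : 0 < (1 + η) * s := by positivity
  have hm : 0 < (1 - η) * s := mul_pos (by linarith) hs
  rw [Real.exp_add, Real.exp_add, ← tsum_primorialRpow hs, ← tsum_primorialRpow hp,
    ← tsum_primorialRpow hm, hardyRamanujanCount_eq_card]
  set T := (finite_setOf_primorialHom_le (Real.exp b)).toFinset with hT
  have h1 := (summable_primorialRpow hp).hasSum.mul_left (Real.exp (η * s * a))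
  have h2 := (summable_primorialRpow hm).hasSum.mul_left (Real.exp (-(η * s * b)))
  have h3 : HasSum (fun n => if n ∈ T then Real.exp (-(s * a)) else 0)
      (Real.exp (-(s * a)) * T.card) := by
    have := hasSum_sum_of_ne_finset_zero (L := .unconditional ℕ) (s := T)
      (f := fun n => if n ∈ T then Real.exp (-(s * a)) else 0) fun n hn => if_neg hn
    rw [Finset.sum_ite_mem, Finset.inter_self, Finset.sum_const, nsmul_eq_mul,
      mul_comm (T.card : ℝ)] at this
    exact this
  refine hasSum_le (fun n => ?_) (summable_primorialRpow hs).hasSum ((h1.add h2).add h3)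
  have p1 : 0 ≤ Real.exp (η * s * a) * primorialRpow _ hp n :=
    mul_nonneg (Real.exp_pos _).le (primorialRpow_nonneg hp n)
  have p2 : 0 ≤ Real.exp (-(η * s * b)) * primorialRpow _ hm n :=
    mul_nonneg (Real.exp_pos _).le (primorialRpow_nonneg hm n)
  have p3 : 0 ≤ (if n ∈ T then Real.exp (-(s * a)) else 0) := by
    split_ifs <;> positivity
  rcases eq_or_ne n 0 with rfl | hn
  · rw [map_zero]; linarith
  set l := Real.log (primorialHom n) with hl
  rcases le_or_gt l a with hla | hla
  · have : primorialRpow s hs n ≤ Real.exp (η * s * a) * primorialRpow _ hp n := by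
      rw [primorialRpow_eq_exp hs hn, primorialRpow_eq_exp hp hn, ← Real.exp_add, Real.exp_le_exp,
        ← hl]
      have := mul_le_mul_of_nonneg_left hla (mul_pos hη hs).le
      linarith
    linarith
  rcases lt_or_ge b l with hlb | hlb
  · have : primorialRpow s hs n ≤ Real.exp (-(η * s * b)) * primorialRpow _ hm n := by
      rw [primorialRpow_eq_exp hs hn, primorialRpow_eq_exp hm hn, ← Real.exp_add, Real.exp_le_exp,
        ← hl]
      have := mul_le_mul_of_nonneg_left hlb.le (mul_pos hη hs).le
      linarith
    linarith
  · have hnT : n ∈ T := by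
      refine (finite_setOf_primorialHom_le (Real.exp b)).mem_toFinset.2 ⟨hn, ?_⟩
      rwa [← primorialHom_eq_exp_log hn, Real.exp_le_exp]
    have : primorialRpow s hs n ≤ if n ∈ T then Real.exp (-(s * a)) else 0 := by
      rw [if_pos hnT, primorialRpow_eq_exp hs hn, Real.exp_le_exp, ← hl]
      have := mul_le_mul_of_nonneg_left hla.le hs.le
      linarith
    linarith

/-! ### The saddle point and the asymptotic count -/

/-- Half of the main term of the logarithm of the number of Hardy–Ramanujan integers up to
`exp u`. -/
noncomputable def mainTerm (u : ℝ) : ℝ := Real.pi * √(u / (3 * Real.log u))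

theorem mainTerm_pos {u : ℝ} (hu : 1 < u) : 0 < mainTerm u := by
  have := Real.log_pos hu
  have := Real.pi_pos
  unfold mainTerm
  positivity

theorem mainTerm_sq {u : ℝ} (hu : 1 < u) :
    mainTerm u ^ 2 = Real.pi ^ 2 * (u / (3 * Real.log u)) := by
  have := Real.log_pos hu
  rw [mainTerm, mul_pow, Real.sq_sqrt (by positivity)]

open Filter Topology in
theorem tendsto_log_div_self_atTop : Tendsto (fun u : ℝ => Real.log u / u) atTop (𝓝 0) := by
  simpa using Real.tendsto_pow_log_div_mul_add_atTop 1 0 1 one_ne_zero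

open Filter Topology in
theorem tendsto_mainTerm : Tendsto mainTerm atTop atTop := by
  have h1 : Tendsto (fun u : ℝ => u / (3 * Real.log u)) atTop atTop := by
    have h2 : Tendsto (fun u : ℝ => 3 * (Real.log u / u)) atTop (𝓝[>] 0) := by
      refine tendsto_nhdsWithin_iff.2 ⟨by simpa using tendsto_log_div_self_atTop.const_mul 3, ?_⟩
      filter_upwards [eventually_gt_atTop 1] with u hu
      have := Real.log_pos hu
      simp only [Set.mem_Ioi]
      positivity
    refine h2.inv_tendsto_nhdsGT_zero.congr fun u => ?_
    simp only [Pi.inv_apply]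
    rw [← mul_div_assoc, inv_div]
  exact (Real.tendsto_sqrt_atTop.comp h1).const_mul_atTop Real.pi_pos

open Filter Topology in
theorem tendsto_mainTerm_div : Tendsto (fun u => mainTerm u / u) atTop (𝓝[>] 0) := by
  refine tendsto_nhdsWithin_iff.2 ⟨?_, ?_⟩
  · have h1 : Tendsto (fun u : ℝ => Real.pi * √(u⁻¹ * (3 * Real.log u)⁻¹)) atTop (𝓝 0) := by
      have e1 : Tendsto (fun u : ℝ => u⁻¹ * (3 * Real.log u)⁻¹) atTop (𝓝 0) := by
        simpa using tendsto_inv_atTop_zero.mul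
          (Real.tendsto_log_atTop.const_mul_atTop (show (0 : ℝ) < 3 by norm_num)).inv_tendsto_atTop
      simpa using (e1.sqrt).const_mul Real.pi
    refine h1.congr' ?_
    filter_upwards [eventually_gt_atTop 1] with u hu
    have hl := Real.log_pos hu
    have hu0 : 0 < u := by linarith
    rw [mainTerm, mul_div_assoc]
    congr 1
    have h2 : u⁻¹ * (3 * Real.log u)⁻¹ = u / (3 * Real.log u) / u ^ 2 := by field_simp
    rw [h2, Real.sqrt_div' _ (by positivity), Real.sqrt_sq hu0.le]
  · filter_upwards [eventually_gt_atTop 1] with u hu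
    exact div_pos (mainTerm_pos hu) (by linarith)

open Filter Topology in
theorem tendsto_log_mainTerm_div_log :
    Tendsto (fun u => -Real.log (mainTerm u / u) / Real.log u) atTop (𝓝 (1 / 2)) := by
  have hl := Real.tendsto_log_atTop
  have h1 := ((hl.const_div_atTop (1 / 2 * Real.log 3 - Real.log Real.pi)).const_add
    (1 / 2)).add ((tendsto_log_div_self_atTop.comp hl).const_mul (1 / 2))
  rw [add_zero, mul_zero, add_zero] at h1
  refine h1.congr' ?_
  filter_upwards [eventually_gt_atTop 1] with u hu
  have hlu := Real.log_pos hu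
  have hu0 : 0 < u := by linarith
  rw [Function.comp_apply, Real.log_div (mainTerm_pos hu).ne' hu0.ne', mainTerm, Real.log_mul Real.pi_ne_zero
    (by positivity), Real.log_sqrt (by positivity), Real.log_div hu0.ne' (by positivity),
    Real.log_mul (by norm_num) hlu.ne']
  field_simp
  ring

-- With `s = B/u`, `log (1/s) ~ (1/2) log u`, so `partitionLog (c s)` is asymptotic to `c⁻¹ (π²/3) u
-- / (B log u)`. This is `c⁻¹ B`, because `B² = π² u / (3 log u)`.
open Filter Topology in
theorem tendsto_partitionLog_div_mainTerm {c : ℝ} (hc : 0 < c) :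
    Tendsto (fun u => partitionLog logPrimorial (c * (mainTerm u / u)) / mainTerm u) atTop
      (𝓝 c⁻¹) := by
  have hs := tendsto_mainTerm_div
  have hcs := (tendsto_const_mul_nhdsGT_zero hc).comp hs
  have e1 := (tendsto_mul_partitionLog succ_mul_log_two_le_logPrimorial
    tendsto_logPrimorial_div).comp hcs
  have e2 := (tendsto_log_div_log_mul hc).comp hs
  have e3 := tendsto_log_mainTerm_div_log
  have e4 := ((e1.mul e2).div (e3.const_mul (Real.pi ^ 2 / 3))
    (by have := Real.pi_ne_zero; positivity)).const_mul c⁻¹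
  have hval : c⁻¹ * (Real.pi ^ 2 / 6 * 1 / (Real.pi ^ 2 / 3 * (1 / 2))) = c⁻¹ := by
    have := Real.pi_ne_zero
    field_simp
    norm_num
  rw [hval] at e4
  refine e4.congr' ?_
  filter_upwards [eventually_gt_atTop 1,
    (tendsto_neg_log_nhdsGT_zero.comp hs).eventually_gt_atTop 0,
    (tendsto_neg_log_nhdsGT_zero.comp hcs).eventually_gt_atTop 0] with u hu h5 h6
  have hlu := Real.log_pos hu
  have hu0 : 0 < u := by linarith
  have hB := mainTerm_pos hu
  have hsq := mainTerm_sq hu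
  simp only [Function.comp_apply, Pi.div_apply] at h5 h6 ⊢
  have hpi := Real.pi_pos
  have h7 : Real.pi ^ 2 / 3 = mainTerm u * (mainTerm u / u) * Real.log u := by
    have : mainTerm u * (mainTerm u / u) = mainTerm u ^ 2 / u := by ring
    rw [this, hsq]
    field_simp
  rw [h7]
  generalize mainTerm u / u = s at *
  have h8 : 0 < s := by
    by_contra hneg
    have h9 : mainTerm u * s * Real.log u ≤ 0 :=
      mul_nonpos_of_nonpos_of_nonneg (mul_nonpos_of_nonneg_of_nonpos hB.le (not_lt.1 hneg)) hlu.le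
    have : 0 < Real.pi ^ 2 / 3 := by positivity
    linarith
  have h9 : Real.log s ≠ 0 := by intro h; simp [h] at h5
  have h10 : Real.log (c * s) ≠ 0 := by intro h; simp [h] at h6
  field_simp

open Filter Topology in
theorem eventually_log_hardyRamanujanCount_le {c : ℝ} (hc : 2 < c) :
    ∀ᶠ u in atTop, Real.log (hardyRamanujanCount (Real.exp u)) ≤ c * mainTerm u := by
  have h := tendsto_partitionLog_div_mainTerm one_pos
  rw [inv_one] at h
  filter_upwards [h.eventually_lt_const (show (1 : ℝ) < c - 1 by linarith),
    eventually_gt_atTop 1] with u h1 hu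
  have hB := mainTerm_pos hu
  have hu0 : 0 < u := by linarith
  have hN : (0 : ℝ) < hardyRamanujanCount (Real.exp u) := by
    exact_mod_cast one_le_hardyRamanujanCount hu0.le
  have h2 := hardyRamanujanCount_exp_le (div_pos hB hu0) u
  rw [one_mul, div_lt_iff₀ hB] at h1
  rw [div_mul_cancel₀ _ hu0.ne', ← Real.log_le_iff_le_exp hN] at h2
  linarith

-- In units of `B`, the full series has exponent about `1`, while the two tails have exponents about
-- `η(1-δ) + (1+η)⁻¹` and `-η(1+δ) + (1-η)⁻¹`. Both are strictly below `1`, so the window between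
-- `(1-δ)u` and `(1+δ)u` carries the series.
open Filter Topology in
theorem eventually_le_log_hardyRamanujanCount_exp {δ : ℝ} (hδ : 0 < δ) (hδ1 : δ < 1) :
    ∀ᶠ u in atTop,
      (2 - 3 * δ) * mainTerm u ≤ Real.log (hardyRamanujanCount (Real.exp ((1 + δ) * u))) := by
  -- With `δ = 2η`, both tail exponents are `1 - η²` up to third order in `η`.
  set η := δ / 2 with hη
  have hη0 : 0 < η := by positivity
  have hη1 : η < 1 / 2 := by linarith
  have l1 : η * (1 - δ) + (1 + η)⁻¹ < 1 := by
    have : (1 + η)⁻¹ < 1 - η * (1 - δ) := by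
      rw [inv_lt_iff_one_lt_mul₀ (by linarith)]
      have : δ = 2 * η := by linarith
      rw [this]
      nlinarith [mul_pos hη0 hη0, mul_pos (mul_pos hη0 hη0) hη0]
    linarith
  have l2 : -(η * (1 + δ)) + (1 - η)⁻¹ < 1 := by
    have : (1 - η)⁻¹ < 1 + η * (1 + δ) := by
      rw [inv_lt_iff_one_lt_mul₀ (by linarith)]
      have : δ = 2 * η := by linarith
      rw [this]
      nlinarith [mul_pos hη0 hη0, mul_pos (mul_pos hη0 hη0) (show 0 < 1 / 2 - η by linarith)]
    linarith
  obtain ⟨q, hq, hq1⟩ := exists_between (max_lt (max_lt l1 l2) (show 1 - δ < 1 by linarith))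
  obtain ⟨q', hqq', hq'1⟩ := exists_between hq1
  rw [max_lt_iff, max_lt_iff] at hq
  have t0 := tendsto_partitionLog_div_mainTerm one_pos
  rw [inv_one] at t0
  have t1 := (tendsto_partitionLog_div_mainTerm (show 0 < 1 + η by linarith)).const_add
    (η * (1 - δ))
  have t2 := (tendsto_partitionLog_div_mainTerm (show 0 < 1 - η by linarith)).const_add
    (-(η * (1 + δ)))
  filter_upwards [t0.eventually_const_lt hq'1, t1.eventually_lt_const hq.1.1,
    t2.eventually_lt_const hq.1.2, eventually_gt_atTop 1,
    (tendsto_mainTerm.const_mul_atTop (sub_pos.2 hqq')).eventually_ge_atTop (Real.log 4),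
    (tendsto_mainTerm.const_mul_atTop hδ).eventually_ge_atTop (Real.log 2)] with
    u e0 e1 e2 hu e3 e4
  have hB := mainTerm_pos hu
  have hu0 : 0 < u := by linarith
  have hN : (0 : ℝ) < hardyRamanujanCount (Real.exp ((1 + δ) * u)) := by
    exact_mod_cast one_le_hardyRamanujanCount (by positivity)
  have key := exp_partitionLog_le (div_pos hB hu0) hη0 (by linarith) ((1 - δ) * u) ((1 + δ) * u)
  rw [one_mul] at e0
  set B := mainTerm u
  set s := B / u with hs
  have hsu : s * u = B := div_mul_cancel₀ _ hu0.ne'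
  set A : ℝ := (hardyRamanujanCount (Real.exp ((1 + δ) * u)) : ℝ)
  rw [lt_div_iff₀ hB] at e0
  rw [← lt_sub_iff_add_lt', div_lt_iff₀ hB] at e1 e2
  have f0 : Real.exp (q' * B) ≤ Real.exp (partitionLog logPrimorial s) :=
    Real.exp_le_exp.2 e0.le
  have f1 : Real.exp (η * s * ((1 - δ) * u) + partitionLog logPrimorial ((1 + η) * s)) ≤
      Real.exp (q * B) := by
    rw [Real.exp_le_exp, show η * s * ((1 - δ) * u) = η * (1 - δ) * B by rw [← hsu]; ring]
    linarith
  have f2 : Real.exp (-(η * s * ((1 + δ) * u)) + partitionLog logPrimorial ((1 - η) * s)) ≤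
      Real.exp (q * B) := by
    rw [Real.exp_le_exp, show η * s * ((1 + δ) * u) = η * (1 + δ) * B by rw [← hsu]; ring]
    linarith
  have f3 : 4 * Real.exp (q * B) ≤ Real.exp (q' * B) := by
    rw [← Real.exp_log (show (0 : ℝ) < 4 by norm_num), ← Real.exp_add, Real.exp_le_exp]
    linarith
  -- By `f3` the two tails together are at most half of the left side. Taking logarithms, the factor
  -- `2` will cost `log 2 ≤ δ * B`, the third `δ` in `2 - 3 * δ`.
  have f4 : Real.exp (q' * B) ≤ 2 * (Real.exp (-(s * ((1 - δ) * u))) * A) := by linarith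
  have f5 := Real.log_le_log (Real.exp_pos _) f4
  rw [Real.log_exp, Real.log_mul (by norm_num) (by positivity),
    Real.log_mul (Real.exp_pos _).ne' hN.ne', Real.log_exp,
    show s * ((1 - δ) * u) = (1 - δ) * B by rw [← hsu]; ring] at f5
  have f6 : (1 - δ) * B ≤ q' * B := by
    have : 1 - δ ≤ q' := by linarith [hq.2]
    gcongr
  linarith

theorem mainTerm_mul_le {δ u : ℝ} (hδ : 0 < δ) (hu : 1 < u) :
    mainTerm ((1 + δ) * u) ≤ (1 + δ) * mainTerm u := by
  have hl := Real.log_pos hu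
  have hu0 : 0 < u := by linarith
  have h1 : Real.log u ≤ Real.log ((1 + δ) * u) :=
    Real.log_le_log hu0 (by nlinarith)
  have h2 : √((1 + δ) * u / (3 * Real.log ((1 + δ) * u))) ≤
      (1 + δ) * √(u / (3 * Real.log u)) := by
    rw [Real.sqrt_le_left (by positivity), mul_pow, Real.sq_sqrt (by positivity)]
    calc _ ≤ (1 + δ) * u / (3 * Real.log u) := by gcongr
      _ = (1 + δ) * (u / (3 * Real.log u)) := by ring
      _ ≤ _ := by
        gcongr
        nlinarith
  have := mul_le_mul_of_nonneg_left h2 Real.pi_pos.le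
  unfold mainTerm
  linarith

-- The window estimate at `w / (1 + δ)` counts up to `e^w`; rescaling the main term costs at most `1
-- + δ`, and `δ` is taken small in terms of `c`.
open Filter Topology in
theorem eventually_le_log_hardyRamanujanCount {c : ℝ} (hc : c < 2) :
    ∀ᶠ u in atTop, c * mainTerm u ≤ Real.log (hardyRamanujanCount (Real.exp u)) := by
  have h1 : Tendsto (fun δ : ℝ => (2 - 3 * δ) / (1 + δ)) (𝓝[>] 0) (𝓝 2) := by
    have : ContinuousAt (fun δ : ℝ => (2 - 3 * δ) / (1 + δ)) 0 := by
      refine ContinuousAt.div (by fun_prop) (by fun_prop) (by norm_num)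
    have := this.tendsto.mono_left (nhdsWithin_le_nhds (s := Set.Ioi 0))
    simpa using this
  obtain ⟨δ, hδc, hδ0, hδ1⟩ := ((h1.eventually_const_lt hc).and
    (Ioo_mem_nhdsGT (show (0 : ℝ) < 1 / 2 by norm_num))).exists
  have h2 : Tendsto (fun w : ℝ => (1 + δ)⁻¹ * w) atTop atTop :=
    tendsto_id.const_mul_atTop (by positivity)
  filter_upwards [h2.eventually (eventually_le_log_hardyRamanujanCount_exp hδ0 (by linarith)),
    h2.eventually_gt_atTop 1] with w h3 h4
  have h5 : (1 + δ) * ((1 + δ)⁻¹ * w) = w := mul_inv_cancel_left₀ (by positivity) w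
  have h6 := mainTerm_mul_le hδ0 h4
  rw [h5] at h3 h6
  refine le_trans ?_ h3
  have h7 : 0 < mainTerm ((1 + δ)⁻¹ * w) := mainTerm_pos h4
  have h8 : 1 < w := by
    rw [← h5]; nlinarith
  calc c * mainTerm w ≤ (2 - 3 * δ) / (1 + δ) * mainTerm w := by
        have := mainTerm_pos h8
        gcongr
    _ ≤ (2 - 3 * δ) / (1 + δ) * ((1 + δ) * mainTerm ((1 + δ)⁻¹ * w)) := by
        have : 0 ≤ (2 - 3 * δ) / (1 + δ) := div_nonneg (by linarith) (by linarith)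
        gcongr
    _ = _ := by field_simp

open Filter Topology in
theorem tendsto_log_hardyRamanujanCount_div :
    Tendsto (fun u => Real.log (hardyRamanujanCount (Real.exp u)) / mainTerm u) atTop (𝓝 2) := by
  refine tendsto_order.2 ⟨fun a ha => ?_, fun a ha => ?_⟩
  · obtain ⟨c, hc, hc2⟩ := exists_between ha
    filter_upwards [eventually_le_log_hardyRamanujanCount hc2, eventually_gt_atTop 1] with u h1 hu
    exact hc.trans_le ((le_div_iff₀ (mainTerm_pos hu)).2 h1)
  · obtain ⟨c, hc, hc2⟩ := exists_between ha
    filter_upwards [eventually_log_hardyRamanujanCount_le hc, eventually_gt_atTop 1] with u h1 hu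
    exact ((div_le_iff₀ (mainTerm_pos hu)).2 h1).trans_lt hc2

open Filter Topology in
theorem exists_hardyRamanujanCount_eq :
    ∃ ε : ℝ → ℝ, Tendsto ε atTop (𝓝 0) ∧ ∀ᶠ x : ℝ in atTop,
      (hardyRamanujanCount x : ℝ) =
        Real.exp ((1 + ε x) *
          (2 * Real.pi * √(Real.log x / (3 * Real.log (Real.log x))))) := by
  refine ⟨fun x => Real.log (hardyRamanujanCount (Real.exp (Real.log x))) /
    mainTerm (Real.log x) / 2 - 1, ?_, ?_⟩
  · have := ((tendsto_log_hardyRamanujanCount_div.comp Real.tendsto_log_atTop).div_const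
      2).sub_const 1
    rw [div_self two_ne_zero, sub_self] at this
    exact this
  · filter_upwards [eventually_gt_atTop (Real.exp 1)] with x hx
    have hx0 : 0 < x := (Real.exp_pos 1).trans hx
    have hl : 1 < Real.log x := (Real.lt_log_iff_exp_lt hx0).2 hx
    have hB := mainTerm_pos hl
    have hN : (0 : ℝ) < hardyRamanujanCount (Real.exp (Real.log x)) := by
      exact_mod_cast one_le_hardyRamanujanCount (by linarith)
    rw [show 2 * Real.pi * √(Real.log x / (3 * Real.log (Real.log x))) =
      2 * mainTerm (Real.log x) by rw [mainTerm]; ring]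
    rw [show (1 + (Real.log (hardyRamanujanCount (Real.exp (Real.log x))) /
      mainTerm (Real.log x) / 2 - 1)) * (2 * mainTerm (Real.log x)) =
      Real.log (hardyRamanujanCount (Real.exp (Real.log x))) by field_simp; ring,
      Real.exp_log hN, Real.exp_log hx0]

theorem mainTheorem10 :
    (∀ x : ℝ,
      (∀ n : ℕ, IsHardyRamanujan n → 5041 ≤ n → (n : ℝ) ≤ x → RobinInequality n) →
        ∀ n : ℕ, 5041 ≤ n → (n : ℝ) ≤ x → RobinInequality n) ∧
    (∃ ε : ℝ → ℝ, Filter.Tendsto ε Filter.atTop (nhds 0) ∧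
      ∀ᶠ x : ℝ in Filter.atTop,
        (hardyRamanujanCount x : ℝ) =
          Real.exp ((1 + ε x) *
            (2 * Real.pi * Real.sqrt (Real.log x / (3 * Real.log (Real.log x)))))) :=
  ⟨robinInequality_of_isHardyRamanujan, exists_hardyRamanujanCount_eq⟩
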